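/- Let $\eta\in[0,1]$, $N_S\ge 0$, $N_B\ge 0$ and $\delta_5>0$. Let $\mathcal{E}_{\eta,N_B}(\rho)=\operatorname{Tr}_b[U(\rho\otimes\rho_b)U^\dagger]$ be the thermal noise channel on one bosonic mode, where $\rho_b=\frac{1}{N_B+1}\sum_{l\ge 0}\left(\frac{N_B}{N_B+1}\right)^l|l\rangle\langle l|$ is the thermal state of mean photon number $N_B$ of an environment mode $b$, and $U$ is the beamsplitter unitary that fixes the vacuum and satisfies $U^\dagger \hat a U=\sqrt{\eta}\,\hat a+\sqrt{1-\eta}\,\hat b$ and $U^\dagger \hat b U=-\sqrt{1-\eta}\,\hat a+\sqrt{\eta}\,\hat b$. For $L\in\mathbb{N}$ let $$\Pi_L=\sum_{a_1,\dots,a_n:\ \sum_i a_i\le L}|a_1\rangle\langle a_1|\otimes\cdots\otimes|a_n\rangle\langle a_n|$$ be the projector onto the subspace of $n$ modes with total photon number at most $L$. Then there is a non-increasing function $\delta_6:\mathbb{N}\to\mathbb{R}$ with $\delta_6(n)\to 0$ as $n\to\infty$, depending only on $\eta,N_S,N_B,\delta_5$, such that for every function $\delta_1:\mathbb{N}\to\mathbb{R}$,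 every natural number $n$ and every density operator $\rho^{(n)}$ on $n$ modes: if $$\operatorname{Tr}\{\Pi_{\lceil nN_S\rceil}\,\rho^{(n)}\}\ \ge\ 1-\delta_1(n),$$ then $$\operatorname{Tr}\bigl\{\Pi_{\lceil n(\eta N_S+(1-\eta)N_B+\delta_5)\rceil}\,\mathcal{E}_{\eta,N_B}^{\otimes n}(\rho^{(n)})\bigr\}\ \ge\ 1-\delta_1(n)-2\sqrt{\delta_1(n)}-\delta_6(n).$$ (The hypothesis forces $\delta_1(n)\ge 0$.) -/

import Mathlib

/-!
Thermal noise bosonic channels in the Fock (photon-number) representation.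

A system whose number basis is indexed by `ι` is `ℓ²(ι, ℂ)`.  A single mode has `ι = ℕ`, and `n`
modes have `ι = Fin n → ℕ`, the basis vector `ket a` being `|a₁⟩ ⊗ ⋯ ⊗ |aₙ⟩`.  The `n` signal
modes together with their `n` environment modes have `ι = (Fin n → ℕ) × (Fin n → ℕ)`.
-/

namespace Bosonic

open scoped ENNReal BigOperators

noncomputable section

/-- The Hilbert space with orthonormal number basis indexed by `ι`. -/
abbrev Fock (ι : Type) : Type := lp (fun _ : ι => ℂ) 2

open Classical in
/-- The number basis vector `|i⟩`. -/
def ket {ι : Type} (i : ι) : Fock ι := lp.single 2 i (1 : ℂ)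

theorem orthonormal_ket {ι : Type} : Orthonormal ℂ (ket : ι → Fock ι) := by
  classical
  rw [orthonormal_iff_ite]
  intro i j
  unfold ket
  rw [lp.inner_single_left, lp.single_apply, Pi.single_apply]
  by_cases h : i = j <;> simp [h]

/-- The isometry that sends `|i⟩` to `v i`, for an orthonormal family `v`. -/
def isometryOf {ι κ : Type} (v : ι → Fock κ) (hv : Orthonormal ℂ v) : Fock ι →ₗᵢ[ℂ] Fock κ :=
  hv.orthogonalFamily.linearIsometry

theorem isometryOf_ket {ι κ : Type} (v : ι → Fock κ) (hv : Orthonormal ℂ v) (i : ι) :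
    isometryOf v hv (ket i) = v i := by
  classical
  unfold isometryOf ket
  rw [OrthogonalFamily.linearIsometry_apply_single]
  simp

/-! ### States and traces -/

/-- `Tr A = ∑ᵢ ⟨i| A |i⟩`. -/
def trace {ι : Type} (A : Fock ι →L[ℂ] Fock ι) : ℂ := ∑' i, inner ℂ (ket i) (A (ket i))

/-- A density operator: a positive operator with `∑ᵢ ⟨i| ρ |i⟩ = 1`, the sum being convergent. -/
structure IsDensityOperator {ι : Type} (ρ : Fock ι →L[ℂ] Fock ι) : Prop where
  isPositive : ρ.IsPositive
  hasSum_trace : HasSum (fun i => inner ℂ (ket i) (ρ (ket i))) (1 : ℂ)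

/-- The photon-number cutoff projector
`Π_L = ∑_{a₁ + ⋯ + aₙ ≤ L} |a₁⟩⟨a₁| ⊗ ⋯ ⊗ |aₙ⟩⟨aₙ|` on `n` modes. -/
def cutoffProj (n L : ℕ) : Fock (Fin n → ℕ) →L[ℂ] Fock (Fin n → ℕ) :=
  ∑ a ∈ (Fintype.piFinset fun _ : Fin n => Finset.range (L + 1)) with ∑ i, a i ≤ L,
    InnerProductSpace.rankOne ℂ (ket a) (ket a)

/-! ### The beamsplitter on one signal mode and one environment mode -/

/-- Finite superpositions of the two-mode number states `|j, k⟩`, with real amplitudes. -/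
abbrev TwoMode : Type := ℕ × ℕ →₀ ℝ

/-- The creation operator of the signal mode: `a† |j, k⟩ = √(j+1) |j+1, k⟩`. -/
def aDag : TwoMode →ₗ[ℝ] TwoMode :=
  Finsupp.linearCombination ℝ fun p : ℕ × ℕ =>
    Finsupp.single (p.1 + 1, p.2) (Real.sqrt ((p.1 : ℝ) + 1))

/-- The creation operator of the environment mode: `b† |j, k⟩ = √(k+1) |j, k+1⟩`. -/
def bDag : TwoMode →ₗ[ℝ] TwoMode :=
  Finsupp.linearCombination ℝ fun p : ℕ × ℕ =>
    Finsupp.single (p.1, p.2 + 1) (Real.sqrt ((p.2 : ℝ) + 1))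

/-- `U a† U†`, where `U† a U = √η a + √(1-η) b` and `U† b U = -√(1-η) a + √η b`. -/
def rotA (η : ℝ) : TwoMode →ₗ[ℝ] TwoMode := Real.sqrt η • aDag - Real.sqrt (1 - η) • bDag

/-- `U b† U†`, where `U† a U = √η a + √(1-η) b` and `U† b U = -√(1-η) a + √η b`. -/
def rotB (η : ℝ) : TwoMode →ₗ[ℝ] TwoMode := Real.sqrt (1 - η) • aDag + Real.sqrt η • bDag

/-- The beamsplitter of transmissivity `η` on number states:
`U |k, l⟩ = (U a† U†)^k (U b† U†)^l |0, 0⟩ / √(k! l!)`. -/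
def beamSplitterState (η : ℝ) (p : ℕ × ℕ) : TwoMode :=
  (Real.sqrt ((p.1.factorial : ℝ) * (p.2.factorial : ℝ)))⁻¹ •
    (rotA η ^ p.1) ((rotB η ^ p.2) (Finsupp.single (0, 0) 1))

/-! The states `beamSplitterState η p` are orthonormal: the operators `U a† U†`, `U b† U†` and
their adjoints satisfy the canonical commutation relations and the adjoints annihilate the
vacuum. -/

/-- The annihilation operator of the signal mode: `a |j, k⟩ = √j |j-1, k⟩`. -/
def aAnn : TwoMode →ₗ[ℝ] TwoMode :=
  Finsupp.linearCombination ℝ fun p : ℕ × ℕ =>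
    Finsupp.single (p.1 - 1, p.2) (Real.sqrt (p.1 : ℝ))

/-- The annihilation operator of the environment mode: `b |j, k⟩ = √k |j, k-1⟩`. -/
def bAnn : TwoMode →ₗ[ℝ] TwoMode :=
  Finsupp.linearCombination ℝ fun p : ℕ × ℕ =>
    Finsupp.single (p.1, p.2 - 1) (Real.sqrt (p.2 : ℝ))

/-- The inner product of two finite superpositions. -/
def dot (f g : TwoMode) : ℝ := Finsupp.linearCombination ℝ (fun p => f p) g

theorem dot_eq_sum (f g : TwoMode) (s : Finset (ℕ × ℕ)) (hs : g.support ⊆ s) :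
    dot f g = ∑ p ∈ s, f p * g p := by
  unfold dot
  rw [Finsupp.linearCombination_apply, Finsupp.sum_of_support_subset _ hs _ (by simp)]
  simp [mul_comm]

theorem dot_comm (f g : TwoMode) : dot f g = dot g f := by
  classical
  rw [dot_eq_sum f g (f.support ∪ g.support) Finset.subset_union_right,
    dot_eq_sum g f (f.support ∪ g.support) Finset.subset_union_left]
  simp [mul_comm]

theorem dot_add_right (f g h : TwoMode) : dot f (g + h) = dot f g + dot f h := by
  simp [dot]

theorem dot_sub_right (f g h : TwoMode) : dot f (g - h) = dot f g - dot f h := by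
  simp [dot]

theorem dot_smul_right (c : ℝ) (f g : TwoMode) : dot f (c • g) = c * dot f g := by
  simp [dot]

theorem dot_add_left (f g h : TwoMode) : dot (f + g) h = dot f h + dot g h := by
  rw [dot_comm, dot_add_right, dot_comm h f, dot_comm h g]

theorem dot_sub_left (f g h : TwoMode) : dot (f - g) h = dot f h - dot g h := by
  rw [dot_comm, dot_sub_right, dot_comm h f, dot_comm h g]

theorem dot_smul_left (c : ℝ) (f g : TwoMode) : dot (c • f) g = c * dot f g := by
  rw [dot_comm, dot_smul_right, dot_comm g f]

theorem dot_single (p q : ℕ × ℕ) (x y : ℝ) :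
    dot (Finsupp.single p x) (Finsupp.single q y) = if p = q then x * y else 0 := by
  unfold dot
  rw [Finsupp.linearCombination_single, Finsupp.single_apply]
  split_ifs <;> simp [mul_comm]

theorem ext_single {S T : TwoMode →ₗ[ℝ] TwoMode}
    (h : ∀ j k : ℕ, S (Finsupp.single (j, k) 1) = T (Finsupp.single (j, k) 1)) : S = T :=
  Finsupp.lhom_ext' fun p => LinearMap.ext_ring (h p.1 p.2)

theorem dot_adjoint {S T : TwoMode →ₗ[ℝ] TwoMode}
    (h : ∀ j k j' k' : ℕ, dot (S (Finsupp.single (j, k) 1)) (Finsupp.single (j', k') 1) =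
      dot (Finsupp.single (j, k) 1) (T (Finsupp.single (j', k') 1))) (f g : TwoMode) :
    dot (S f) g = dot f (T g) := by
  induction f using Finsupp.induction_linear with
  | zero => rw [map_zero, dot_comm, dot_comm 0]; simp [dot]
  | add f₁ f₂ h₁ h₂ => rw [map_add, dot_add_left, dot_add_left, h₁, h₂]
  | single p x =>
    induction g using Finsupp.induction_linear with
    | zero => simp [dot]
    | add g₁ g₂ h₁ h₂ => rw [map_add, dot_add_right, dot_add_right, h₁, h₂]
    | single q y =>
      have hx : (Finsupp.single p x : TwoMode) = x • Finsupp.single (p.1, p.2) 1 := by simp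
      have hy : (Finsupp.single q y : TwoMode) = y • Finsupp.single (q.1, q.2) 1 := by simp
      rw [hx, hy, map_smul, map_smul, dot_smul_left, dot_smul_left, dot_smul_right,
        dot_smul_right, h]

theorem aDag_single (j k : ℕ) (x : ℝ) :
    aDag (Finsupp.single (j, k) x) = Finsupp.single (j + 1, k) (x * Real.sqrt ((j : ℝ) + 1)) := by
  simp [aDag]

theorem bDag_single (j k : ℕ) (x : ℝ) :
    bDag (Finsupp.single (j, k) x) = Finsupp.single (j, k + 1) (x * Real.sqrt ((k : ℝ) + 1)) := by
  simp [bDag]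

theorem aAnn_single (j k : ℕ) (x : ℝ) :
    aAnn (Finsupp.single (j, k) x) = Finsupp.single (j - 1, k) (x * Real.sqrt (j : ℝ)) := by
  simp [aAnn]

theorem bAnn_single (j k : ℕ) (x : ℝ) :
    bAnn (Finsupp.single (j, k) x) = Finsupp.single (j, k - 1) (x * Real.sqrt (k : ℝ)) := by
  simp [bAnn]

theorem dot_aDag (f g : TwoMode) : dot (aDag f) g = dot f (aAnn g) := by
  refine dot_adjoint (fun j k j' k' => ?_) f g
  rw [aDag_single, aAnn_single, dot_single, dot_single]
  rcases j' with _ | j'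
  · simp
  · by_cases h : j = j' ∧ k = k'
    · obtain ⟨rfl, rfl⟩ := h
      simp
    · have h1 : ¬ ((j + 1, k) = (j' + 1, k')) := by simpa using h
      have h2 : ¬ ((j, k) = (j' + 1 - 1, k')) := by simpa using h
      rw [if_neg h1, if_neg h2]

theorem dot_bDag (f g : TwoMode) : dot (bDag f) g = dot f (bAnn g) := by
  refine dot_adjoint (fun j k j' k' => ?_) f g
  rw [bDag_single, bAnn_single, dot_single, dot_single]
  rcases k' with _ | k'
  · simp
  · by_cases h : j = j' ∧ k = k'
    · obtain ⟨rfl, rfl⟩ := h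
      simp
    · have h1 : ¬ ((j, k + 1) = (j', k' + 1)) := by simpa using h
      have h2 : ¬ ((j, k) = (j', k' + 1 - 1)) := by simpa using h
      rw [if_neg h1, if_neg h2]

theorem aAnn_aDag (f : TwoMode) : aAnn (aDag f) = aDag (aAnn f) + f := by
  suffices h : aAnn * aDag = aDag * aAnn + 1 from LinearMap.congr_fun h f
  refine ext_single fun j k => ?_
  simp only [Module.End.mul_apply, LinearMap.add_apply, Module.End.one_apply, aAnn_single,
    aDag_single]
  rcases j with _ | j
  · simp
  · simp only [Nat.add_sub_cancel, ← Finsupp.single_add]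
    congr 1
    push_cast
    rw [one_mul, one_mul, Real.mul_self_sqrt (by positivity), Real.mul_self_sqrt (by positivity)]

theorem bAnn_bDag (f : TwoMode) : bAnn (bDag f) = bDag (bAnn f) + f := by
  suffices h : bAnn * bDag = bDag * bAnn + 1 from LinearMap.congr_fun h f
  refine ext_single fun j k => ?_
  simp only [Module.End.mul_apply, LinearMap.add_apply, Module.End.one_apply, bAnn_single,
    bDag_single]
  rcases k with _ | k
  · simp
  · simp only [Nat.add_sub_cancel, ← Finsupp.single_add]
    congr 1
    push_cast
    rw [one_mul, one_mul, Real.mul_self_sqrt (by positivity), Real.mul_self_sqrt (by positivity)]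

theorem aAnn_bDag (f : TwoMode) : aAnn (bDag f) = bDag (aAnn f) := by
  suffices h : aAnn * bDag = bDag * aAnn from LinearMap.congr_fun h f
  refine ext_single fun j k => ?_
  simp [aAnn_single, bDag_single, mul_comm]

theorem bAnn_aDag (f : TwoMode) : bAnn (aDag f) = aDag (bAnn f) := by
  suffices h : bAnn * aDag = aDag * bAnn from LinearMap.congr_fun h f
  refine ext_single fun j k => ?_
  simp [bAnn_single, aDag_single, mul_comm]

/-- The adjoint of `rotA η`. -/
def rotAnnA (η : ℝ) : TwoMode →ₗ[ℝ] TwoMode := Real.sqrt η • aAnn - Real.sqrt (1 - η) • bAnn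

/-- The adjoint of `rotB η`. -/
def rotAnnB (η : ℝ) : TwoMode →ₗ[ℝ] TwoMode := Real.sqrt (1 - η) • aAnn + Real.sqrt η • bAnn

theorem dot_rotA (η : ℝ) (f g : TwoMode) : dot (rotA η f) g = dot f (rotAnnA η g) := by
  simp only [rotA, rotAnnA, LinearMap.sub_apply, LinearMap.smul_apply, dot_sub_left,
    dot_sub_right, dot_smul_left, dot_smul_right, dot_aDag, dot_bDag]

theorem dot_rotB (η : ℝ) (f g : TwoMode) : dot (rotB η f) g = dot f (rotAnnB η g) := by
  simp only [rotB, rotAnnB, LinearMap.add_apply, LinearMap.smul_apply, dot_add_left,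
    dot_add_right, dot_smul_left, dot_smul_right, dot_aDag, dot_bDag]

theorem sqrt_add_sqrt {η : ℝ} (h0 : 0 ≤ η) (h1 : η ≤ 1) :
    Real.sqrt η * Real.sqrt η + Real.sqrt (1 - η) * Real.sqrt (1 - η) = 1 := by
  rw [Real.mul_self_sqrt h0, Real.mul_self_sqrt (by linarith)]
  ring

theorem rotAnnA_rotA {η : ℝ} (h0 : 0 ≤ η) (h1 : η ≤ 1) (f : TwoMode) :
    rotAnnA η (rotA η f) = rotA η (rotAnnA η f) + f := by
  have h : rotAnnA η (rotA η f) = rotA η (rotAnnA η f) +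
      (Real.sqrt η * Real.sqrt η + Real.sqrt (1 - η) * Real.sqrt (1 - η)) • f := by
    simp only [rotA, rotAnnA, LinearMap.sub_apply, LinearMap.smul_apply, map_sub, map_smul,
      aAnn_aDag, bAnn_bDag, aAnn_bDag, bAnn_aDag]
    module
  rw [h, sqrt_add_sqrt h0 h1, one_smul]

theorem rotAnnB_rotB {η : ℝ} (h0 : 0 ≤ η) (h1 : η ≤ 1) (f : TwoMode) :
    rotAnnB η (rotB η f) = rotB η (rotAnnB η f) + f := by
  have h : rotAnnB η (rotB η f) = rotB η (rotAnnB η f) +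
      (Real.sqrt η * Real.sqrt η + Real.sqrt (1 - η) * Real.sqrt (1 - η)) • f := by
    simp only [rotB, rotAnnB, LinearMap.add_apply, LinearMap.smul_apply, map_add, map_smul,
      aAnn_aDag, bAnn_bDag, aAnn_bDag, bAnn_aDag]
    module
  rw [h, sqrt_add_sqrt h0 h1, one_smul]

theorem rotAnnA_rotB (η : ℝ) (f : TwoMode) : rotAnnA η (rotB η f) = rotB η (rotAnnA η f) := by
  simp only [rotB, rotAnnA, LinearMap.sub_apply, LinearMap.add_apply, LinearMap.smul_apply,
    map_sub, map_add, map_smul, aAnn_aDag, bAnn_bDag, aAnn_bDag, bAnn_aDag]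
  module

theorem rotAnnB_rotA (η : ℝ) (f : TwoMode) : rotAnnB η (rotA η f) = rotA η (rotAnnB η f) := by
  simp only [rotA, rotAnnB, LinearMap.sub_apply, LinearMap.add_apply, LinearMap.smul_apply,
    map_sub, map_add, map_smul, aAnn_aDag, bAnn_bDag, aAnn_bDag, bAnn_aDag]
  module

theorem ladder_pow {S T : TwoMode →ₗ[ℝ] TwoMode} (h : ∀ f, S (T f) = T (S f) + f) (k : ℕ)
    (f : TwoMode) : S ((T ^ (k + 1)) f) = ((k : ℝ) + 1) • (T ^ k) f + (T ^ (k + 1)) (S f) := by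
  induction k with
  | zero => simp [h, add_comm]
  | succ k ih =>
    rw [pow_succ' T (k + 1), Module.End.mul_apply, h, ih, map_add, map_smul,
      ← Module.End.mul_apply, ← Module.End.mul_apply, ← pow_succ', ← pow_succ']
    push_cast
    module

theorem commute_pow {S T : TwoMode →ₗ[ℝ] TwoMode} (h : ∀ f, S (T f) = T (S f)) (k : ℕ)
    (f : TwoMode) : S ((T ^ k) f) = (T ^ k) (S f) := by
  induction k with
  | zero => simp
  | succ k ih => rw [pow_succ', Module.End.mul_apply, h, ih, Module.End.mul_apply]

theorem rotAnnA_vacuum (η : ℝ) : rotAnnA η (Finsupp.single (0, 0) 1) = 0 := by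
  simp [rotAnnA, aAnn_single, bAnn_single]

theorem rotAnnB_vacuum (η : ℝ) : rotAnnB η (Finsupp.single (0, 0) 1) = 0 := by
  simp [rotAnnB, aAnn_single, bAnn_single]

theorem dot_rotB_pow {η : ℝ} (h0 : 0 ≤ η) (h1 : η ≤ 1) (l l' : ℕ) :
    dot ((rotB η ^ l) (Finsupp.single (0, 0) 1)) ((rotB η ^ l') (Finsupp.single (0, 0) 1)) =
      if l = l' then (l.factorial : ℝ) else 0 := by
  induction l generalizing l' with
  | zero =>
    rcases l' with _ | l'
    · simp [dot_single]
    · rw [dot_comm, pow_succ', Module.End.mul_apply, dot_rotB, pow_zero, Module.End.one_apply,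
        rotAnnB_vacuum]
      simp [dot]
  | succ l ih =>
    rw [pow_succ', Module.End.mul_apply, dot_rotB]
    rcases l' with _ | l'
    · rw [pow_zero, Module.End.one_apply, rotAnnB_vacuum]
      simp [dot]
    · rw [ladder_pow (rotAnnB_rotB h0 h1), rotAnnB_vacuum, map_zero, add_zero, dot_smul_right, ih]
      by_cases h : l = l'
      · subst h
        simp [Nat.factorial_succ]
      · simp [h]

theorem dot_rot_pow {η : ℝ} (h0 : 0 ≤ η) (h1 : η ≤ 1) (k l k' l' : ℕ) :
    dot ((rotA η ^ k) ((rotB η ^ l) (Finsupp.single (0, 0) 1)))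
        ((rotA η ^ k') ((rotB η ^ l') (Finsupp.single (0, 0) 1))) =
      if k = k' ∧ l = l' then (k.factorial : ℝ) * (l.factorial : ℝ) else 0 := by
  have hv : ∀ m : ℕ, rotAnnA η ((rotB η ^ m) (Finsupp.single (0, 0) 1)) = 0 := fun m => by
    rw [commute_pow (rotAnnA_rotB η), rotAnnA_vacuum, map_zero]
  induction k generalizing k' with
  | zero =>
    rcases k' with _ | k'
    · simp [dot_rotB_pow h0 h1]
    · rw [dot_comm, pow_succ', Module.End.mul_apply, dot_rotA, pow_zero, Module.End.one_apply, hv]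
      simp [dot]
  | succ k ih =>
    rw [pow_succ', Module.End.mul_apply, dot_rotA]
    rcases k' with _ | k'
    · rw [pow_zero, Module.End.one_apply, hv]
      simp [dot]
    · rw [ladder_pow (rotAnnA_rotA h0 h1), hv, map_zero, add_zero, dot_smul_right, ih]
      by_cases h : k = k' ∧ l = l'
      · obtain ⟨rfl, rfl⟩ := h
        simp [Nat.factorial_succ]
        ring
      · simp [h]

theorem dot_beamSplitterState {η : ℝ} (h0 : 0 ≤ η) (h1 : η ≤ 1) (p q : ℕ × ℕ) :
    dot (beamSplitterState η p) (beamSplitterState η q) = if p = q then 1 else 0 := by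
  obtain ⟨k, l⟩ := p
  obtain ⟨k', l'⟩ := q
  unfold beamSplitterState
  rw [dot_smul_left, dot_smul_right, dot_rot_pow h0 h1]
  by_cases h : k = k' ∧ l = l'
  · obtain ⟨rfl, rfl⟩ := h
    simp only [and_self, if_true]
    have hpos : (0 : ℝ) < (k.factorial : ℝ) * (l.factorial : ℝ) := by positivity
    have hs := Real.mul_self_sqrt hpos.le
    have hne : Real.sqrt ((k.factorial : ℝ) * (l.factorial : ℝ)) ≠ 0 :=
      (Real.sqrt_pos.mpr hpos).ne'
    field_simp
    rw [sq, hs]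
  · simp [h]

/-! ### `n` uses of the beamsplitter -/

/-- The matrix element `⟨q| U^{⊗n} |p⟩` of the `n`-fold tensor power of the beamsplitter, a
product of single-mode matrix elements. -/
def beamSplitterCoeff (n : ℕ) (η : ℝ) (p q : (Fin n → ℕ) × (Fin n → ℕ)) : ℝ :=
  ∏ i, beamSplitterState η (p.1 i, p.2 i) (q.1 i, q.2 i)

open Classical in
/-- A finite set outside which `⟨·| U^{⊗n} |p⟩` vanishes. -/
def beamSplitterSupport (n : ℕ) (η : ℝ) (p : (Fin n → ℕ) × (Fin n → ℕ)) :
    Finset ((Fin n → ℕ) × (Fin n → ℕ)) :=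
  (Fintype.piFinset fun i => (beamSplitterState η (p.1 i, p.2 i)).support).map
    (Equiv.arrowProdEquivProdArrow (Fin n) (fun _ => ℕ) (fun _ => ℕ)).toEmbedding

theorem mem_beamSplitterSupport {n : ℕ} {η : ℝ} {p q : (Fin n → ℕ) × (Fin n → ℕ)}
    (h : beamSplitterCoeff n η p q ≠ 0) : q ∈ beamSplitterSupport n η p := by
  unfold beamSplitterSupport
  rw [Finset.mem_map_equiv, Fintype.mem_piFinset]
  intro i
  rw [Finsupp.mem_support_iff]
  exact Finset.prod_ne_zero_iff.mp h i (Finset.mem_univ i)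

theorem memℓp_beamSplitterCoeff (n : ℕ) (η : ℝ) (p : (Fin n → ℕ) × (Fin n → ℕ)) :
    Memℓp (fun q : (Fin n → ℕ) × (Fin n → ℕ) => ((beamSplitterCoeff n η p q : ℝ) : ℂ)) 2 := by
  refine (memℓp_zero ?_).of_exponent_ge zero_le
  refine (beamSplitterSupport n η p).finite_toSet.subset fun q hq => ?_
  exact mem_beamSplitterSupport (by simpa using hq)

/-- The vector `U^{⊗n} |p⟩`. -/
def beamSplitterVec (n : ℕ) (η : ℝ) (p : (Fin n → ℕ) × (Fin n → ℕ)) :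
    Fock ((Fin n → ℕ) × (Fin n → ℕ)) :=
  ⟨fun q => ((beamSplitterCoeff n η p q : ℝ) : ℂ), memℓp_beamSplitterCoeff n η p⟩

theorem orthonormal_beamSplitterVec (n : ℕ) {η : ℝ} (h0 : 0 ≤ η) (h1 : η ≤ 1) :
    Orthonormal ℂ (beamSplitterVec n η) := by
  classical
  rw [orthonormal_iff_ite]
  intro p p'
  have hin : inner ℂ (beamSplitterVec n η p) (beamSplitterVec n η p') =
      ((∑ q ∈ beamSplitterSupport n η p, beamSplitterCoeff n η p q * beamSplitterCoeff n η p' q :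
        ℝ) : ℂ) := by
    rw [lp.inner_eq_tsum, tsum_eq_sum (s := beamSplitterSupport n η p)]
    · push_cast
      refine Finset.sum_congr rfl fun q _ => ?_
      simp [beamSplitterVec, mul_comm]
    · intro q hq
      have : beamSplitterCoeff n η p q = 0 := by
        by_contra h
        exact hq (mem_beamSplitterSupport h)
      simp [beamSplitterVec, this]
  have hsum : ∑ q ∈ beamSplitterSupport n η p,
      beamSplitterCoeff n η p q * beamSplitterCoeff n η p' q =
      ∏ i, dot (beamSplitterState η (p'.1 i, p'.2 i)) (beamSplitterState η (p.1 i, p.2 i)) := by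
    have : ∀ i, dot (beamSplitterState η (p'.1 i, p'.2 i)) (beamSplitterState η (p.1 i, p.2 i)) =
        ∑ x ∈ (beamSplitterState η (p.1 i, p.2 i)).support,
          beamSplitterState η (p.1 i, p.2 i) x * beamSplitterState η (p'.1 i, p'.2 i) x := by
      intro i
      rw [dot_eq_sum _ _ _ (Finset.Subset.refl _)]
      exact Finset.sum_congr rfl fun x _ => mul_comm _ _
    simp_rw [this]
    rw [Finset.prod_univ_sum, beamSplitterSupport, Finset.sum_map]
    refine Finset.sum_congr rfl fun x _ => ?_
    simp [beamSplitterCoeff, Equiv.arrowProdEquivProdArrow, Finset.prod_mul_distrib]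
  rw [hin, hsum]
  simp_rw [dot_beamSplitterState h0 h1]
  by_cases h : p = p'
  · subst h
    simp
  · rw [if_neg h]
    have : ∃ i, (p'.1 i, p'.2 i) ≠ (p.1 i, p.2 i) := by
      by_contra hc
      push Not at hc
      apply h
      ext i
      · exact (congrArg Prod.fst (hc i)).symm
      · exact (congrArg Prod.snd (hc i)).symm
    obtain ⟨i, hi⟩ := this
    rw [Finset.prod_eq_zero (Finset.mem_univ i) (if_neg hi)]
    simp

/-- The `n`-fold beamsplitter `U^{⊗n}` on `n` signal and `n` environment modes. -/
def beamSplitter (n : ℕ) (η : Set.Icc (0 : ℝ) 1) :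
    Fock ((Fin n → ℕ) × (Fin n → ℕ)) →L[ℂ] Fock ((Fin n → ℕ) × (Fin n → ℕ)) :=
  (isometryOf (beamSplitterVec n η)
    (orthonormal_beamSplitterVec n η.2.1 η.2.2)).toContinuousLinearMap

/-! ### The thermal channel -/

theorem orthonormal_ket_pair {ι κ : Type} (k : κ) :
    Orthonormal ℂ (fun i : ι => (ket (i, k) : Fock (ι × κ))) :=
  orthonormal_ket.comp _ fun _ _ h => (Prod.mk.inj h).1

/-- The map `ψ ↦ ψ ⊗ |k⟩`. -/
def attach {ι κ : Type} (k : κ) : Fock ι →L[ℂ] Fock (ι × κ) :=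
  (isometryOf (fun i : ι => ket (i, k)) (orthonormal_ket_pair k)).toContinuousLinearMap

/-- The operator `ρ ⊗ (∑ₖ w(k) |k⟩⟨k|) = ∑ₖ w(k) (ρ ⊗ |k⟩⟨k|)`. -/
def tensorDiagonal {ι κ : Type} (ρ : Fock ι →L[ℂ] Fock ι) (w : κ → ℝ) :
    Fock (ι × κ) →L[ℂ] Fock (ι × κ) :=
  ∑' k, (w k : ℂ) • (attach k ∘L ρ ∘L (attach k).adjoint)

/-- The partial trace over the second system, `Tr₂ T = ∑ₖ (1 ⊗ ⟨k|) T (1 ⊗ |k⟩)`. -/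
def partialTrace {ι κ : Type} (T : Fock (ι × κ) →L[ℂ] Fock (ι × κ)) : Fock ι →L[ℂ] Fock ι :=
  ∑' k, (attach k).adjoint ∘L T ∘L attach k

/-- The eigenvalue, at the number state `|b₁⟩ ⊗ ⋯ ⊗ |bₙ⟩`, of `n` copies of the thermal state
`(N + 1)⁻¹ ∑ₗ (N / (N + 1))^l |l⟩⟨l|` of mean photon number `N`. -/
def thermalWeight (n : ℕ) (N : ℝ) (b : Fin n → ℕ) : ℝ :=
  ∏ i, 1 / (N + 1) * (N / (N + 1)) ^ b i

/-- `n` uses `E_{η,N}^{⊗n}` of the thermal noise channel of transmissivity `η` and noise photon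
number `N`: `ρ ↦ Tr_b [U^{⊗n} (ρ ⊗ ρ_b^{⊗n}) U^{⊗n}†]` with `ρ_b` the thermal state of mean
photon number `N`. -/
def thermalChannel (n : ℕ) (η : Set.Icc (0 : ℝ) 1) (N : ℝ)
    (ρ : Fock (Fin n → ℕ) →L[ℂ] Fock (Fin n → ℕ)) : Fock (Fin n → ℕ) →L[ℂ] Fock (Fin n → ℕ) :=
  partialTrace
    (beamSplitter n η ∘L tensorDiagonal ρ (thermalWeight n N) ∘L (beamSplitter n η).adjoint)

end

end Bosonic

namespace Bosonic

open scoped ENNReal BigOperators InnerProduct ComplexOrder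

noncomputable section

/-! ### Diagonal matrix elements -/

/-! The cutoff projector is diagonal in the number basis, so only the diagonal matrix elements of
the channel output matter. These depend on `ρ` through its diagonal alone. The thermal state is
diagonal, and each beamsplitter conserves the photon number of its pair of modes. So once the
environment input `b` and the outputs `(c, d)` are fixed, the only signal input that can contribute
is `c + d - b`, and no coherence between different number states survives
(`adjoint_attach_adjoint_beamSplitter`). The output count is therefore distributed as a classical
mixture, with weights `⟨a|ρ|a⟩`, of the counts produced by number states `|a⟩`
(`tsum_diag_jointOutput_indicator`).

For a fixed `a` the modes are independent. The ladder relations of the rotated operators give the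
mean `η a + (1-η) N` and an explicit variance in each mode, affine in `a`. If `∑ aᵢ ≤ ⌈n N_S⌉`, the
total mean exceeds `n(η N_S + (1-η) N_B)` by at most the rounding error and the total variance is
`O(n)`, so Chebyshev's inequality with deviation of order `n δ₅` bounds the tail by `C / n`. Inputs
above the cutoff have total weight at most `δ₁ n` and are counted as lost.

This gives `1 - δ₁ n - C / n` for large `n`, and the term `2 √(δ₁ n)` is slack: in this classical
picture no estimate of how the state is disturbed by the projection is needed. For small `n` the
function `δ₆` is at least `1` and the bound is trivial.

The series of operators must also be shown to converge in norm, since `tsum` has the value `0`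
otherwise. Rearrangements of sums of probabilities are done in `ℝ≥0∞`. -/

/-- The real part of the diagonal matrix element `⟨i| A |i⟩`. -/
def diag {ι : Type} (A : Fock ι →L[ℂ] Fock ι) (i : ι) : ℝ := (inner ℂ (ket i) (A (ket i))).re

theorem inner_ket_left {ι : Type} (i : ι) (x : Fock ι) : inner ℂ (ket i) x = x i := by
  classical
  unfold ket
  rw [lp.inner_single_left]
  simp

theorem inner_ket_right {ι : Type} (i : ι) (x : Fock ι) :
    inner ℂ x (ket i) = (starRingEnd ℂ) (x i) := by
  rw [← inner_conj_symm, inner_ket_left]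

theorem ket_apply {ι : Type} [DecidableEq ι] (i j : ι) :
    (ket i : Fock ι) j = if i = j then 1 else 0 := by
  rw [← inner_ket_left]
  have := orthonormal_iff_ite.mp (orthonormal_ket (ι := ι)) j i
  simp only [this, eq_comm]

theorem hasSum_norm_sq {ι : Type} (x : Fock ι) : HasSum (fun i => ‖x i‖ ^ 2) (‖x‖ ^ 2) := by
  have h := lp.hasSum_norm (p := 2) (by simp) x
  simpa using h

theorem diag_nonneg {ι : Type} {A : Fock ι →L[ℂ] Fock ι} (hA : A.IsPositive) (i : ι) :
    0 ≤ diag A i :=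
  hA.re_inner_nonneg_right (ket i)

theorem exists_eq_adjoint_comp_self {H : Type*} [NormedAddCommGroup H] [InnerProductSpace ℂ H]
    [CompleteSpace H] {A : H →L[ℂ] H} (hA : A.IsPositive) : ∃ B : H →L[ℂ] H, A = B.adjoint ∘L B :=
  CStarAlgebra.nonneg_iff_eq_star_mul_self.mp
    ((ContinuousLinearMap.nonneg_iff_isPositive A).mpr hA)

/-- With `A = B†B` the diagonal entries are `‖B|i⟩‖²`. Cauchy–Schwarz in each coordinate `⟨B i, y⟩`
of `B† y` gives `‖B† y‖² ≤ t ‖y‖²`. This domination of the norm by the trace makes the partial trace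
converge. -/
theorem norm_le_of_hasSum_diag {ι : Type} {A : Fock ι →L[ℂ] Fock ι} (hA : A.IsPositive) {t : ℝ}
    (h : HasSum (diag A) t) : ‖A‖ ≤ t := by
  obtain ⟨B, rfl⟩ := exists_eq_adjoint_comp_self hA
  have ht : 0 ≤ t := h.nonneg fun i => diag_nonneg hA i
  have hd : ∀ i, diag (B.adjoint ∘L B) i = ‖B (ket i)‖ ^ 2 := by
    intro i
    rw [diag, ContinuousLinearMap.comp_apply,
      ContinuousLinearMap.adjoint_inner_right, inner_self_eq_norm_sq_to_K]
    norm_cast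
  have hB : ‖B.adjoint‖ ≤ Real.sqrt t := by
    refine ContinuousLinearMap.opNorm_le_bound _ (Real.sqrt_nonneg _) fun y => ?_
    refine le_of_sq_le_sq ?_ (by positivity)
    rw [mul_pow, Real.sq_sqrt ht]
    refine hasSum_le (fun i => ?_) (hasSum_norm_sq (B.adjoint y)) (h.mul_right (‖y‖ ^ 2))
    rw [hd, ← mul_pow, ← inner_ket_left, ContinuousLinearMap.adjoint_inner_right]
    gcongr
    exact norm_inner_le_norm _ _
  rw [ContinuousLinearMap.norm_adjoint_comp_self, ← LinearIsometryEquiv.norm_map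
    ContinuousLinearMap.adjoint B]
  nlinarith [Real.mul_self_sqrt ht, norm_nonneg (B.adjoint), Real.sqrt_nonneg t]

theorem hasSum_quadratic {ι κ : Type} {A : κ → Fock ι →L[ℂ] Fock ι} {S : Fock ι →L[ℂ] Fock ι}
    (h : HasSum A S) (x : Fock ι) :
    HasSum (fun k => inner ℂ x (A k x)) (inner ℂ x (S x)) :=
  h.mapL ((innerSL ℂ x) ∘L (ContinuousLinearMap.apply ℂ (Fock ι) x))

theorem hasSum_diag {ι κ : Type} {A : κ → Fock ι →L[ℂ] Fock ι} {S : Fock ι →L[ℂ] Fock ι}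
    (h : HasSum A S) (i : ι) : HasSum (fun k => diag (A k) i) (diag S i) :=
  (hasSum_quadratic h (ket i)).mapL Complex.reCLM

theorem isPositive_of_inner_nonneg {ι : Type} {A : Fock ι →L[ℂ] Fock ι}
    (h : ∀ x, 0 ≤ inner ℂ x (A x)) : A.IsPositive := by
  rw [ContinuousLinearMap.isPositive_iff_complex]
  intro x
  have hx := h x
  rw [← inner_conj_symm] at hx
  rw [Complex.le_def] at hx
  obtain ⟨h1, h2⟩ := hx
  simp only [Complex.zero_re, Complex.zero_im, Complex.conj_re, Complex.conj_im] at h1 h2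
  refine ⟨?_, h1⟩
  apply Complex.ext
  · simp
  · simp; linarith

theorem isPositive_of_hasSum {ι κ : Type} {A : κ → Fock ι →L[ℂ] Fock ι}
    {S : Fock ι →L[ℂ] Fock ι} (h : HasSum A S) (hA : ∀ k, (A k).IsPositive) : S.IsPositive :=
  isPositive_of_inner_nonneg fun x =>
    (hasSum_quadratic h x).nonneg fun k => (hA k).inner_nonneg_right x

/-! ### Attaching and tracing out a number basis -/

theorem attach_ket {ι κ : Type} (k : κ) (i : ι) : attach k (ket i) = (ket (i, k) : Fock (ι × κ)) :=
  isometryOf_ket _ (orthonormal_ket_pair k) i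

theorem norm_attach_le {ι κ : Type} (k : κ) : ‖(attach k : Fock ι →L[ℂ] Fock (ι × κ))‖ ≤ 1 :=
  LinearIsometry.norm_toContinuousLinearMap_le _

/-- `attach k` is an isometry, so the terms are bounded in norm by `|w k| ‖ρ‖`. -/
theorem hasSum_tensorDiagonal {ι κ : Type} (ρ : Fock ι →L[ℂ] Fock ι) {w : κ → ℝ}
    (hw : Summable w) :
    HasSum (fun k => (w k : ℂ) • (attach k ∘L ρ ∘L (attach k).adjoint)) (tensorDiagonal ρ w) := by
  refine Summable.hasSum (Summable.of_norm_bounded (hw.abs.mul_right ‖ρ‖) fun k => ?_)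
  rw [norm_smul, Complex.norm_real, Real.norm_eq_abs]
  gcongr
  have h1 := norm_attach_le (ι := ι) k
  have h2 : ‖(attach k : Fock ι →L[ℂ] Fock (ι × κ)).adjoint‖ ≤ 1 := by
    rwa [LinearIsometryEquiv.norm_map]
  calc _ ≤ ‖(attach k : Fock ι →L[ℂ] Fock (ι × κ))‖ *
        (‖ρ‖ * ‖(attach k : Fock ι →L[ℂ] Fock (ι × κ)).adjoint‖) :=
        (ContinuousLinearMap.opNorm_comp_le _ _).trans
          (mul_le_mul_of_nonneg_left (ContinuousLinearMap.opNorm_comp_le _ _) (norm_nonneg _))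
    _ ≤ 1 * (‖ρ‖ * 1) := by gcongr
    _ = ‖ρ‖ := by ring

theorem isPositive_tensorDiagonal {ι κ : Type} {ρ : Fock ι →L[ℂ] Fock ι} (hρ : ρ.IsPositive)
    {w : κ → ℝ} (hw : Summable w) (h0 : ∀ k, 0 ≤ w k) : (tensorDiagonal ρ w).IsPositive :=
  isPositive_of_hasSum (hasSum_tensorDiagonal ρ hw) fun k =>
    (hρ.conj_adjoint (attach k)).smul_of_nonneg (by exact_mod_cast h0 k)

theorem diag_slice {ι κ : Type} (T : Fock (ι × κ) →L[ℂ] Fock (ι × κ)) (k : κ) (i : ι) :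
    diag ((attach k).adjoint ∘L T ∘L attach k) i = diag T (i, k) := by
  simp only [diag, ContinuousLinearMap.comp_apply, ContinuousLinearMap.adjoint_inner_right,
    attach_ket]

/-- Each slice is positive, so its norm is at most its trace, and the slice traces are the partial
sums over `ι` of a summable family. -/
theorem hasSum_partialTrace {ι κ : Type} {T : Fock (ι × κ) →L[ℂ] Fock (ι × κ)}
    (hT : T.IsPositive) (h : Summable (diag T)) :
    HasSum (fun k => (attach k).adjoint ∘L T ∘L attach k) (partialTrace T) := by
  have hs : Summable fun x : κ × ι => diag T (x.2, x.1) :=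
    h.comp_injective (Prod.swap_injective)
  refine Summable.hasSum (Summable.of_norm_bounded hs.prod fun k => ?_)
  refine norm_le_of_hasSum_diag (hT.adjoint_conj _) ?_
  simp_rw [funext (diag_slice T k)]
  exact (hs.prod_factor k).hasSum

theorem hasSum_diag_partialTrace {ι κ : Type} {T : Fock (ι × κ) →L[ℂ] Fock (ι × κ)}
    (hT : T.IsPositive) (h : Summable (diag T)) (i : ι) :
    HasSum (fun k => diag T (i, k)) (diag (partialTrace T) i) := by
  simpa only [diag_slice] using hasSum_diag (hasSum_partialTrace hT h) i

/-! ### The photon-number cutoff -/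

/-- The number states of `n` modes with at most `L` photons in total. -/
def cutoffSet (n L : ℕ) : Finset (Fin n → ℕ) :=
  (Fintype.piFinset fun _ : Fin n => Finset.range (L + 1)).filter fun a => ∑ i, a i ≤ L

theorem mem_cutoffSet {n L : ℕ} {a : Fin n → ℕ} : a ∈ cutoffSet n L ↔ ∑ i, a i ≤ L := by
  rw [cutoffSet, Finset.mem_filter, and_iff_right_iff_imp, Fintype.mem_piFinset]
  intro h i
  have := Finset.single_le_sum (f := a) (fun _ _ => Nat.zero_le _) (Finset.mem_univ i)
  exact Finset.mem_range.mpr (by omega)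

/-- Reduces both sides of the theorem to finite sums of diagonal entries. -/
theorem trace_cutoffProj_re (n L : ℕ) (A : Fock (Fin n → ℕ) →L[ℂ] Fock (Fin n → ℕ)) :
    (trace (cutoffProj n L ∘L A)).re = ∑ a ∈ cutoffSet n L, diag A a := by
  classical
  have h : ∀ i, inner ℂ (ket i) ((cutoffProj n L ∘L A) (ket i)) =
      if i ∈ cutoffSet n L then inner ℂ (ket i) (A (ket i)) else 0 := by
    intro i
    have hc : cutoffProj n L = ∑ a ∈ cutoffSet n L, InnerProductSpace.rankOne ℂ (ket a) (ket a) :=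
      rfl
    rw [ContinuousLinearMap.comp_apply, hc, sum_apply, inner_sum]
    simp_rw [InnerProductSpace.rankOne_apply, inner_smul_right,
      orthonormal_iff_ite.mp (orthonormal_ket (ι := Fin n → ℕ))]
    simp
  rw [trace]
  simp_rw [h]
  rw [tsum_eq_sum (s := cutoffSet n L) (fun i hi => if_neg hi), Complex.re_sum]
  exact Finset.sum_congr rfl fun i hi => by rw [if_pos hi]; rfl

/-! ### Diagonal matrix elements after the beamsplitter -/

theorem aDag_mem_supported {m : ℕ} {f : TwoMode}
    (hf : f ∈ Finsupp.supported ℝ ℝ {q : ℕ × ℕ | q.1 + q.2 = m}) :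
    aDag f ∈ Finsupp.supported ℝ ℝ {q : ℕ × ℕ | q.1 + q.2 = m + 1} := by
  rw [aDag, Finsupp.linearCombination_apply]
  refine Submodule.sum_mem _ fun q hq => Submodule.smul_mem _ _ (Finsupp.single_mem_supported _ _ ?_)
  have : q.1 + q.2 = m := hf hq
  simp only [Set.mem_ofPred_eq]
  omega

theorem bDag_mem_supported {m : ℕ} {f : TwoMode}
    (hf : f ∈ Finsupp.supported ℝ ℝ {q : ℕ × ℕ | q.1 + q.2 = m}) :
    bDag f ∈ Finsupp.supported ℝ ℝ {q : ℕ × ℕ | q.1 + q.2 = m + 1} := by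
  rw [bDag, Finsupp.linearCombination_apply]
  refine Submodule.sum_mem _ fun q hq => Submodule.smul_mem _ _ (Finsupp.single_mem_supported _ _ ?_)
  have : q.1 + q.2 = m := hf hq
  simp only [Set.mem_ofPred_eq]
  omega

/-- Each factor `rotA` or `rotB` raises the total photon number by exactly one, starting from the
vacuum. -/
theorem beamSplitterState_mem_supported (η : ℝ) (p : ℕ × ℕ) :
    beamSplitterState η p ∈ Finsupp.supported ℝ ℝ {q : ℕ × ℕ | q.1 + q.2 = p.1 + p.2} := by
  have hB : ∀ l, (rotB η ^ l) (Finsupp.single (0, 0) 1) ∈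
      Finsupp.supported ℝ ℝ {q : ℕ × ℕ | q.1 + q.2 = l} := by
    intro l
    induction l with
    | zero => exact Finsupp.single_mem_supported _ _ (by simp)
    | succ l ih =>
      rw [pow_succ', Module.End.mul_apply]
      exact Submodule.add_mem _ (Submodule.smul_mem _ _ (aDag_mem_supported ih))
        (Submodule.smul_mem _ _ (bDag_mem_supported ih))
  have hA : ∀ k l, (rotA η ^ k) ((rotB η ^ l) (Finsupp.single (0, 0) 1)) ∈
      Finsupp.supported ℝ ℝ {q : ℕ × ℕ | q.1 + q.2 = k + l} := by
    intro k l
    induction k with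
    | zero => simpa using hB l
    | succ k ih =>
      rw [pow_succ', Module.End.mul_apply, Nat.add_right_comm]
      exact Submodule.sub_mem _ (Submodule.smul_mem _ _ (aDag_mem_supported ih))
        (Submodule.smul_mem _ _ (bDag_mem_supported ih))
  exact Submodule.smul_mem _ _ (hA p.1 p.2)

theorem photonNumber_conserved {η : ℝ} {p q : ℕ × ℕ} (h : beamSplitterState η p q ≠ 0) :
    q.1 + q.2 = p.1 + p.2 :=
  beamSplitterState_mem_supported η p (Finsupp.mem_support_iff.mpr h)

/-- The subtraction is truncated. This is harmless: a nonzero coefficient forces `a + b = q.1 +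
q.2`, and then it is exact. -/
theorem beamSplitterCoeff_eq_zero {n : ℕ} {η : ℝ} {a b : Fin n → ℕ}
    {q : (Fin n → ℕ) × (Fin n → ℕ)} (h : a ≠ q.1 + q.2 - b) :
    beamSplitterCoeff n η (a, b) q = 0 := by
  obtain ⟨i, hi⟩ := Function.ne_iff.mp h
  refine Finset.prod_eq_zero (Finset.mem_univ i) ?_
  by_contra h0
  have := photonNumber_conserved h0
  apply hi
  simp only [Pi.sub_apply, Pi.add_apply] at *
  omega

theorem beamSplitter_ket (n : ℕ) (η : Set.Icc (0 : ℝ) 1) (p : (Fin n → ℕ) × (Fin n → ℕ)) :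
    beamSplitter n η (ket p) = beamSplitterVec n η p :=
  isometryOf_ket _ (orthonormal_beamSplitterVec n η.2.1 η.2.2) p

theorem tsum_beamSplitterCoeff_sq (n : ℕ) (η : Set.Icc (0 : ℝ) 1)
    (p : (Fin n → ℕ) × (Fin n → ℕ)) :
    ∑' q, ENNReal.ofReal (beamSplitterCoeff n η p q ^ 2) = 1 := by
  have h := hasSum_norm_sq (beamSplitterVec n η p)
  rw [(orthonormal_beamSplitterVec n η.2.1 η.2.2).1 p] at h
  have h' : HasSum (fun q => beamSplitterCoeff n η p q ^ 2) 1 := by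
    simpa [beamSplitterVec] using h
  rw [← ENNReal.ofReal_tsum_of_nonneg (fun _ => sq_nonneg _) h'.summable, h'.tsum_eq,
    ENNReal.ofReal_one]

/-- This is where coherences disappear: by photon-number conservation `U†|q⟩`, projected on
environment input `b`, is a multiple of a single number state, so `ρ` is only ever tested on its
diagonal. -/
theorem adjoint_attach_adjoint_beamSplitter (n : ℕ) (η : Set.Icc (0 : ℝ) 1) (b : Fin n → ℕ)
    (q : (Fin n → ℕ) × (Fin n → ℕ)) :
    (attach b).adjoint ((beamSplitter n η).adjoint (ket q)) =
      (beamSplitterCoeff n η (q.1 + q.2 - b, b) q : ℂ) • ket (q.1 + q.2 - b) := by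
  classical
  ext a
  rw [← inner_ket_left, ContinuousLinearMap.adjoint_inner_right,
    ContinuousLinearMap.adjoint_inner_right, attach_ket, beamSplitter_ket, inner_ket_right,
    lp.coeFn_smul, Pi.smul_apply, ket_apply]
  have hv : (beamSplitterVec n η (a, b)) q = ((beamSplitterCoeff n η (a, b) q : ℝ) : ℂ) := rfl
  rw [hv, Complex.conj_ofReal]
  by_cases h : q.1 + q.2 - b = a
  · simp [h]
  · simp [h, beamSplitterCoeff_eq_zero (fun h' => h h'.symm)]

/-- The joint state of the signal and environment modes after the beamsplitters. -/
def jointOutput (n : ℕ) (η : Set.Icc (0 : ℝ) 1) (w : (Fin n → ℕ) → ℝ)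
    (ρ : Fock (Fin n → ℕ) →L[ℂ] Fock (Fin n → ℕ)) :
    Fock ((Fin n → ℕ) × (Fin n → ℕ)) →L[ℂ] Fock ((Fin n → ℕ) × (Fin n → ℕ)) :=
  beamSplitter n η ∘L tensorDiagonal ρ w ∘L (beamSplitter n η).adjoint

theorem isPositive_jointOutput {n : ℕ} (η : Set.Icc (0 : ℝ) 1) {w : (Fin n → ℕ) → ℝ}
    (hw : Summable w) (h0 : ∀ b, 0 ≤ w b) {ρ : Fock (Fin n → ℕ) →L[ℂ] Fock (Fin n → ℕ)}
    (hρ : ρ.IsPositive) : (jointOutput n η w ρ).IsPositive :=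
  (isPositive_tensorDiagonal hρ hw h0).conj_adjoint _

theorem hasSum_diag_jointOutput {n : ℕ} (η : Set.Icc (0 : ℝ) 1) {w : (Fin n → ℕ) → ℝ}
    (hw : Summable w) (ρ : Fock (Fin n → ℕ) →L[ℂ] Fock (Fin n → ℕ))
    (q : (Fin n → ℕ) × (Fin n → ℕ)) :
    HasSum (fun b => w b * (diag ρ (q.1 + q.2 - b) *
      beamSplitterCoeff n η (q.1 + q.2 - b, b) q ^ 2)) (diag (jointOutput n η w ρ) q) := by
  have h := (hasSum_quadratic (hasSum_tensorDiagonal ρ hw)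
    ((beamSplitter n η).adjoint (ket q))).mapL Complex.reCLM
  have hr : Complex.reCLM (inner ℂ ((beamSplitter n η).adjoint (ket q))
      (tensorDiagonal ρ w ((beamSplitter n η).adjoint (ket q)))) =
      diag (jointOutput n η w ρ) q := by
    rw [ContinuousLinearMap.adjoint_inner_left]
    rfl
  rw [hr] at h
  convert h using 1
  funext b
  rw [smul_apply, inner_smul_right, ContinuousLinearMap.comp_apply,
    ← ContinuousLinearMap.adjoint_inner_left, ContinuousLinearMap.comp_apply,
    adjoint_attach_adjoint_beamSplitter, map_smul, inner_smul_left, inner_smul_right,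
    Complex.conj_ofReal, Complex.reCLM_apply, Complex.re_ofReal_mul, Complex.re_ofReal_mul,
    Complex.re_ofReal_mul, diag]
  ring

/-- The sum over `a` has at most one nonzero term; inserting it removes the truncated subtraction
and leaves a sum ready for Tonelli. -/
theorem ofReal_diag_jointOutput {n : ℕ} (η : Set.Icc (0 : ℝ) 1) {w : (Fin n → ℕ) → ℝ}
    (hw : Summable w) (h0 : ∀ b, 0 ≤ w b) {ρ : Fock (Fin n → ℕ) →L[ℂ] Fock (Fin n → ℕ)}
    (hρ : ρ.IsPositive) (q : (Fin n → ℕ) × (Fin n → ℕ)) :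
    ENNReal.ofReal (diag (jointOutput n η w ρ) q) =
      ∑' b, ∑' a, ENNReal.ofReal (w b) * (ENNReal.ofReal (diag ρ a) *
        ENNReal.ofReal (beamSplitterCoeff n η (a, b) q ^ 2)) := by
  have h := hasSum_diag_jointOutput η hw ρ q
  rw [← h.tsum_eq, ENNReal.ofReal_tsum_of_nonneg
    (fun b => mul_nonneg (h0 b) (mul_nonneg (diag_nonneg hρ _) (sq_nonneg _))) h.summable]
  refine tsum_congr fun b => ?_
  rw [tsum_eq_single (q.1 + q.2 - b), ENNReal.ofReal_mul (h0 b),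
    ENNReal.ofReal_mul (diag_nonneg hρ _)]
  intro a ha
  simp [beamSplitterCoeff_eq_zero ha]

theorem tsum_diag_jointOutput_indicator {n : ℕ} (η : Set.Icc (0 : ℝ) 1) {w : (Fin n → ℕ) → ℝ}
    (hw : Summable w) (h0 : ∀ b, 0 ≤ w b) {ρ : Fock (Fin n → ℕ) →L[ℂ] Fock (Fin n → ℕ)}
    (hρ : ρ.IsPositive) (s : Set ((Fin n → ℕ) × (Fin n → ℕ))) :
    ∑' q, s.indicator (fun q => ENNReal.ofReal (diag (jointOutput n η w ρ) q)) q =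
      ∑' a, ENNReal.ofReal (diag ρ a) * ∑' b, ENNReal.ofReal (w b) *
        ∑' q, s.indicator (fun q => ENNReal.ofReal (beamSplitterCoeff n η (a, b) q ^ 2)) q := by
  classical
  simp_rw [← ENNReal.tsum_mul_left]
  have h : ∀ q, s.indicator (fun q => ENNReal.ofReal (diag (jointOutput n η w ρ) q)) q =
      ∑' b, ∑' a, ENNReal.ofReal (diag ρ a) * (ENNReal.ofReal (w b) *
        s.indicator (fun q => ENNReal.ofReal (beamSplitterCoeff n η (a, b) q ^ 2)) q) := by
    intro q
    by_cases hq : q ∈ s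
    · simp_rw [Set.indicator_of_mem hq, ofReal_diag_jointOutput η hw h0 hρ q]
      exact tsum_congr fun b => tsum_congr fun a => by ring
    · simp [Set.indicator_of_notMem hq]
  simp_rw [h]
  rw [ENNReal.tsum_comm]
  calc _ = ∑' b, ∑' a, ∑' q, ENNReal.ofReal (diag ρ a) * (ENNReal.ofReal (w b) *
        s.indicator (fun q => ENNReal.ofReal (beamSplitterCoeff n η (a, b) q ^ 2)) q) :=
        tsum_congr fun b => ENNReal.tsum_comm
    _ = _ := ENNReal.tsum_comm

/-! ### Normalisation of the joint output and its cutoff probability -/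

theorem IsDensityOperator.hasSum_diag {ι : Type} {ρ : Fock ι →L[ℂ] Fock ι}
    (hρ : IsDensityOperator ρ) : HasSum (diag ρ) 1 := by
  simpa using! hρ.hasSum_trace.mapL Complex.reCLM

theorem IsDensityOperator.tsum_ofReal_diag {ι : Type} {ρ : Fock ι →L[ℂ] Fock ι}
    (hρ : IsDensityOperator ρ) : ∑' i, ENNReal.ofReal (diag ρ i) = 1 := by
  rw [← ENNReal.ofReal_tsum_of_nonneg (diag_nonneg hρ.isPositive) hρ.hasSum_diag.summable,
    hρ.hasSum_diag.tsum_eq, ENNReal.ofReal_one]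

theorem tsum_diag_jointOutput {n : ℕ} (η : Set.Icc (0 : ℝ) 1) {w : (Fin n → ℕ) → ℝ}
    (hw : HasSum w 1) (h0 : ∀ b, 0 ≤ w b) {ρ : Fock (Fin n → ℕ) →L[ℂ] Fock (Fin n → ℕ)}
    (hρ : IsDensityOperator ρ) :
    ∑' q, ENNReal.ofReal (diag (jointOutput n η w ρ) q) = 1 := by
  have h := tsum_diag_jointOutput_indicator η hw.summable h0 hρ.isPositive Set.univ
  simp only [Set.indicator_univ, tsum_beamSplitterCoeff_sq, mul_one] at h
  rw [h, ← ENNReal.ofReal_tsum_of_nonneg h0 hw.summable, hw.tsum_eq]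
  simp [hρ.tsum_ofReal_diag]

theorem summable_diag_jointOutput {n : ℕ} (η : Set.Icc (0 : ℝ) 1) {w : (Fin n → ℕ) → ℝ}
    (hw : HasSum w 1) (h0 : ∀ b, 0 ≤ w b) {ρ : Fock (Fin n → ℕ) →L[ℂ] Fock (Fin n → ℕ)}
    (hρ : IsDensityOperator ρ) : Summable (diag (jointOutput n η w ρ)) := by
  have h := ENNReal.summable_toReal
    ((tsum_diag_jointOutput η hw h0 hρ).trans_ne ENNReal.one_ne_top)
  simpa only [ENNReal.toReal_ofReal
    (diag_nonneg (isPositive_jointOutput η hw.summable h0 hρ.isPositive) _)] using h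

theorem ofReal_diag_partialTrace {ι κ : Type} {J : Fock (ι × κ) →L[ℂ] Fock (ι × κ)}
    (hJ : J.IsPositive) (hs : Summable (diag J)) (c : ι) :
    ENNReal.ofReal (diag (partialTrace J) c) = ∑' d, ENNReal.ofReal (diag J (c, d)) := by
  have hp := hasSum_diag_partialTrace hJ hs c
  rw [← hp.tsum_eq, ENNReal.ofReal_tsum_of_nonneg (fun _ => diag_nonneg hJ _) hp.summable]

theorem diag_partialTrace_nonneg {ι κ : Type} {J : Fock (ι × κ) →L[ℂ] Fock (ι × κ)}
    (hJ : J.IsPositive) (hs : Summable (diag J)) (c : ι) : 0 ≤ diag (partialTrace J) c :=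
  (hasSum_diag_partialTrace hJ hs c).nonneg fun _ => diag_nonneg hJ _

theorem tsum_indicator_cutoff {n : ℕ} (g : (Fin n → ℕ) × (Fin n → ℕ) → ℝ≥0∞) (L : ℕ) :
    ∑' q, {q : (Fin n → ℕ) × (Fin n → ℕ) | L < ∑ i, q.1 i}ᶜ.indicator g q =
      ∑ c ∈ cutoffSet n L, ∑' d, g (c, d) := by
  rw [ENNReal.tsum_prod', tsum_eq_sum (s := cutoffSet n L)]
  · refine Finset.sum_congr rfl fun c hc => tsum_congr fun d => Set.indicator_of_mem ?_ _
    exact not_lt.mpr (mem_cutoffSet.mp hc)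
  · intro c hc
    refine ENNReal.tsum_eq_zero.mpr fun d => Set.indicator_of_notMem ?_ _
    exact fun h => hc (mem_cutoffSet.mpr (not_lt.mp h))

theorem ofReal_sum_diag_partialTrace {n : ℕ}
    {J : Fock ((Fin n → ℕ) × (Fin n → ℕ)) →L[ℂ] Fock ((Fin n → ℕ) × (Fin n → ℕ))}
    (hJ : J.IsPositive) (hs : Summable (diag J)) (L : ℕ) :
    ENNReal.ofReal (∑ c ∈ cutoffSet n L, diag (partialTrace J) c) =
      ∑' q, {q : (Fin n → ℕ) × (Fin n → ℕ) | L < ∑ i, q.1 i}ᶜ.indicator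
        (fun q => ENNReal.ofReal (diag J q)) q := by
  rw [tsum_indicator_cutoff,
    ENNReal.ofReal_sum_of_nonneg fun c _ => diag_partialTrace_nonneg hJ hs c]
  exact Finset.sum_congr rfl fun c _ => ofReal_diag_partialTrace hJ hs c

/-- A lower bound on the probability that at most `L` photons come out, given an upper bound `ε` on
the probability that more than `L` photons come out on the number states in the set `s`. -/
theorem cutoff_partialTrace_jointOutput_ge {n : ℕ} (η : Set.Icc (0 : ℝ) 1)
    {w : (Fin n → ℕ) → ℝ} (hw : HasSum w 1) (h0 : ∀ b, 0 ≤ w b)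
    {ρ : Fock (Fin n → ℕ) →L[ℂ] Fock (Fin n → ℕ)} (hρ : IsDensityOperator ρ)
    (s : Finset (Fin n → ℕ)) (L : ℕ) {ε : ℝ} (hε : 0 ≤ ε)
    (hs : ∀ a ∈ s, ∑' b, ENNReal.ofReal (w b) * ∑' q, {q : (Fin n → ℕ) × (Fin n → ℕ) |
      L < ∑ i, q.1 i}.indicator (fun q => ENNReal.ofReal (beamSplitterCoeff n η (a, b) q ^ 2)) q ≤
        ENNReal.ofReal ε) :
    ∑ a ∈ s, diag ρ a - ε ≤
      ∑ c ∈ cutoffSet n L, diag (partialTrace (jointOutput n η w ρ)) c := by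
  classical
  set J := jointOutput n η w ρ with hJ
  have hJp : J.IsPositive := isPositive_jointOutput η hw.summable h0 hρ.isPositive
  have hJs : Summable (diag J) := summable_diag_jointOutput η hw h0 hρ
  have hout : ∀ c, 0 ≤ diag (partialTrace J) c := fun c =>
    (hasSum_diag_partialTrace hJp hJs c).nonneg fun k => diag_nonneg hJp _
  set g : (Fin n → ℕ) × (Fin n → ℕ) → ℝ≥0∞ := fun q => ENNReal.ofReal (diag J q) with hg
  set B : Set ((Fin n → ℕ) × (Fin n → ℕ)) := {q | L < ∑ i, q.1 i} with hB
  have hgood : ENNReal.ofReal (∑ c ∈ cutoffSet n L, diag (partialTrace J) c) =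
      ∑' q, Bᶜ.indicator g q := ofReal_sum_diag_partialTrace hJp hJs L
  have htot : ∑' q, B.indicator g q + ∑' q, Bᶜ.indicator g q = 1 := by
    rw [← ENNReal.tsum_add, ← tsum_diag_jointOutput η hw h0 hρ]
    exact tsum_congr fun q => congrFun (Set.indicator_self_add_compl B g) q
  -- Inputs in `s` fail with probability at most `ε`; inputs outside `s` are charged their whole
  -- weight.
  have hbad : ∑' q, B.indicator g q ≤
      ENNReal.ofReal ε + ∑' a, (↑s : Set (Fin n → ℕ))ᶜ.indicator
        (fun a => ENNReal.ofReal (diag ρ a)) a := by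
    rw [tsum_diag_jointOutput_indicator η hw.summable h0 hρ.isPositive B]
    calc _ ≤ ∑' a, (ENNReal.ofReal (diag ρ a) * ENNReal.ofReal ε +
          (↑s : Set (Fin n → ℕ))ᶜ.indicator (fun a => ENNReal.ofReal (diag ρ a)) a) := by
          refine ENNReal.tsum_le_tsum fun a => ?_
          by_cases ha : a ∈ s
          · exact le_add_right (by gcongr; exact hs a ha)
          · refine le_add_left ?_
            rw [Set.indicator_of_mem (by simpa using ha)]
            refine mul_le_of_le_one_right' ?_
            calc _ ≤ ∑' b, ENNReal.ofReal (w b) * 1 := by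
                  gcongr with b
                  rw [← tsum_beamSplitterCoeff_sq n η (a, b)]
                  exact ENNReal.tsum_le_tsum fun q => Set.indicator_le_self _ _ _
              _ = 1 := by
                  simp_rw [mul_one]
                  rw [← ENNReal.ofReal_tsum_of_nonneg h0 hw.summable, hw.tsum_eq,
                    ENNReal.ofReal_one]
      _ = _ := by
          rw [ENNReal.tsum_add, ENNReal.tsum_mul_right, hρ.tsum_ofReal_diag, one_mul]
  have hin : ENNReal.ofReal (∑ a ∈ s, diag ρ a) + ∑' a, (↑s : Set (Fin n → ℕ))ᶜ.indicator
      (fun a => ENNReal.ofReal (diag ρ a)) a = 1 := by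
    rw [ENNReal.ofReal_sum_of_nonneg fun a _ => diag_nonneg hρ.isPositive a,
      ← hρ.tsum_ofReal_diag, sum_eq_tsum_indicator, ← ENNReal.tsum_add]
    exact tsum_congr fun a => congrFun (Set.indicator_self_add_compl _ _) a
  set out := ∑' a, (↑s : Set (Fin n → ℕ))ᶜ.indicator (fun a => ENNReal.ofReal (diag ρ a)) a
  -- Finiteness allows the weight outside `s` to be cancelled between the two decompositions of
  -- total mass one.
  have hofin : out ≠ ⊤ := fun h => by simp [h] at hin
  have h1 : ENNReal.ofReal (∑ a ∈ s, diag ρ a) + out ≤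
      (ENNReal.ofReal ε + ENNReal.ofReal (∑ c ∈ cutoffSet n L, diag (partialTrace J) c)) + out := by
    rw [hin, ← htot, ← hgood]
    calc _ ≤ (ENNReal.ofReal ε + out) +
          ENNReal.ofReal (∑ c ∈ cutoffSet n L, diag (partialTrace J) c) := by gcongr
      _ = _ := by ring
  have h2 := (ENNReal.add_le_add_iff_right hofin).mp h1
  have hnn : 0 ≤ ∑ c ∈ cutoffSet n L, diag (partialTrace J) c :=
    Finset.sum_nonneg fun c _ => hout c
  rw [← ENNReal.ofReal_add hε hnn, ENNReal.ofReal_le_ofReal_iff (by positivity)] at h2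
  linarith

/-! ### Photon-number moments of one beamsplitter output -/

theorem aDag_bDag (f : TwoMode) : aDag (bDag f) = bDag (aDag f) := by
  suffices h : aDag * bDag = bDag * aDag from LinearMap.congr_fun h f
  refine ext_single fun j k => ?_
  simp [aDag_single, bDag_single, mul_comm]

theorem rotB_rotA (η : ℝ) (f : TwoMode) : rotB η (rotA η f) = rotA η (rotB η f) := by
  simp only [rotA, rotB, LinearMap.sub_apply, LinearMap.add_apply, LinearMap.smul_apply, map_sub,
    map_add, map_smul, aDag_bDag]
  module

/-- The rotated operators act on the beamsplitter states as the original ladder operators act on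
number states. This and its three companions allow moments to be computed without explicit
amplitudes. -/
theorem rotA_beamSplitterState (η : ℝ) (k l : ℕ) :
    rotA η (beamSplitterState η (k, l)) =
      Real.sqrt ((k : ℝ) + 1) • beamSplitterState η (k + 1, l) := by
  simp only [beamSplitterState]
  rw [map_smul, ← Module.End.mul_apply, ← pow_succ', smul_smul, Nat.factorial_succ]
  congr 1
  push_cast
  rw [mul_assoc, Real.sqrt_mul (x := (k : ℝ) + 1) (by positivity), mul_inv, ← mul_assoc, mul_inv_cancel₀, one_mul]
  positivity

theorem rotB_beamSplitterState (η : ℝ) (k l : ℕ) :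
    rotB η (beamSplitterState η (k, l)) =
      Real.sqrt ((l : ℝ) + 1) • beamSplitterState η (k, l + 1) := by
  simp only [beamSplitterState]
  rw [map_smul, commute_pow (rotB_rotA η), ← Module.End.mul_apply (rotB η), ← pow_succ', smul_smul,
    Nat.factorial_succ]
  congr 1
  push_cast
  rw [mul_left_comm, Real.sqrt_mul (x := (l : ℝ) + 1) (by positivity), mul_inv, ← mul_assoc, mul_inv_cancel₀, one_mul]
  positivity

theorem rotAnnA_beamSplitterState {η : ℝ} (h0 : 0 ≤ η) (h1 : η ≤ 1) (k l : ℕ) :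
    rotAnnA η (beamSplitterState η (k, l)) =
      Real.sqrt (k : ℝ) • beamSplitterState η (k - 1, l) := by
  have hv : rotAnnA η ((rotB η ^ l) (Finsupp.single (0, 0) 1)) = 0 := by
    rw [commute_pow (rotAnnA_rotB η), rotAnnA_vacuum, map_zero]
  rcases k with _ | k
  · simp [beamSplitterState, hv]
  · have hne : Real.sqrt ((k : ℝ) + 1) ≠ 0 := by positivity
    have h := congrArg (rotAnnA η) (rotA_beamSplitterState η k l)
    have hk : rotAnnA η (rotA η (beamSplitterState η (k, l))) =
        ((k : ℝ) + 1) • beamSplitterState η (k, l) := by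
      simp only [beamSplitterState, map_smul]
      rw [← Module.End.mul_apply (rotA η), ← pow_succ', ladder_pow (rotAnnA_rotA h0 h1), hv,
        map_zero, add_zero, smul_comm]
    rw [hk, map_smul] at h
    rw [Nat.add_sub_cancel, Nat.cast_succ]
    refine (smul_right_injective _ hne) ?_
    simp only
    rw [← h, smul_smul, Real.mul_self_sqrt (by positivity)]

theorem rotAnnB_beamSplitterState {η : ℝ} (h0 : 0 ≤ η) (h1 : η ≤ 1) (k l : ℕ) :
    rotAnnB η (beamSplitterState η (k, l)) =
      Real.sqrt (l : ℝ) • beamSplitterState η (k, l - 1) := by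
  rcases l with _ | l
  · simp [beamSplitterState, commute_pow (rotAnnB_rotA η), rotAnnB_vacuum]
  · have hne : Real.sqrt ((l : ℝ) + 1) ≠ 0 := by positivity
    have h := congrArg (rotAnnB η) (rotB_beamSplitterState η k l)
    have hl : rotAnnB η (rotB η (beamSplitterState η (k, l))) =
        ((l : ℝ) + 1) • beamSplitterState η (k, l) := by
      simp only [beamSplitterState, map_smul]
      rw [commute_pow (rotB_rotA η), ← Module.End.mul_apply (rotB η), ← pow_succ',
        commute_pow (rotAnnB_rotA η), ladder_pow (rotAnnB_rotB h0 h1), rotAnnB_vacuum,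
        map_zero, add_zero, map_smul, smul_comm]
    rw [hl, map_smul] at h
    rw [Nat.add_sub_cancel, Nat.cast_succ]
    refine (smul_right_injective _ hne) ?_
    simp only
    rw [← h, smul_smul, Real.mul_self_sqrt (by positivity)]

theorem aDag_eq_rot {η : ℝ} (h0 : 0 ≤ η) (h1 : η ≤ 1) (f : TwoMode) :
    aDag f = Real.sqrt η • rotA η f + Real.sqrt (1 - η) • rotB η f := by
  have h : Real.sqrt η • rotA η f + Real.sqrt (1 - η) • rotB η f =
      (Real.sqrt η * Real.sqrt η + Real.sqrt (1 - η) * Real.sqrt (1 - η)) • aDag f := by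
    simp only [rotA, rotB, LinearMap.sub_apply, LinearMap.add_apply, LinearMap.smul_apply]
    module
  rw [h, sqrt_add_sqrt h0 h1, one_smul]

theorem aAnn_eq_rot {η : ℝ} (h0 : 0 ≤ η) (h1 : η ≤ 1) (f : TwoMode) :
    aAnn f = Real.sqrt η • rotAnnA η f + Real.sqrt (1 - η) • rotAnnB η f := by
  have h : Real.sqrt η • rotAnnA η f + Real.sqrt (1 - η) • rotAnnB η f =
      (Real.sqrt η * Real.sqrt η + Real.sqrt (1 - η) * Real.sqrt (1 - η)) • aAnn f := by
    simp only [rotAnnA, rotAnnB, LinearMap.sub_apply, LinearMap.add_apply, LinearMap.smul_apply]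
    module
  rw [h, sqrt_add_sqrt h0 h1, one_smul]

/-- At `k = 0` the truncated index `k - 1 + 1` is wrong, but the factor `√0` kills the term. -/
theorem sqrt_smul_sqrt_sub_one (k : ℕ) (f : ℕ → TwoMode) :
    (Real.sqrt (k : ℝ) * Real.sqrt (((k - 1 : ℕ) : ℝ) + 1)) • f (k - 1 + 1) = (k : ℝ) • f k := by
  rcases k with _ | k
  · simp
  · simp only [Nat.add_sub_cancel, Nat.cast_succ]
    rw [Real.mul_self_sqrt (by positivity)]

/-- Expands the number operator, written in rotated ladder operators, over beamsplitter states. By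
orthonormality the diagonal coefficient is the mean, and the other two carry the variance. -/
theorem aDag_aAnn_beamSplitterState {η : ℝ} (h0 : 0 ≤ η) (h1 : η ≤ 1) (k l : ℕ) :
    aDag (aAnn (beamSplitterState η (k, l))) =
      (η * k + (1 - η) * l) • beamSplitterState η (k, l) +
        ((Real.sqrt η * Real.sqrt (1 - η) * (Real.sqrt k * Real.sqrt ((l : ℝ) + 1))) •
            beamSplitterState η (k - 1, l + 1) +
          (Real.sqrt η * Real.sqrt (1 - η) * (Real.sqrt l * Real.sqrt ((k : ℝ) + 1))) •
            beamSplitterState η (k + 1, l - 1)) := by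
  have hk := sqrt_smul_sqrt_sub_one k fun k => beamSplitterState η (k, l)
  have hl := sqrt_smul_sqrt_sub_one l fun l => beamSplitterState η (k, l)
  have e1 : Real.sqrt η * Real.sqrt η = η := Real.mul_self_sqrt h0
  have e2 : Real.sqrt (1 - η) * Real.sqrt (1 - η) = 1 - η := Real.mul_self_sqrt (by linarith)
  have e : (η * k + (1 - η) * l) • beamSplitterState η (k, l) =
      (Real.sqrt η * Real.sqrt η) • ((Real.sqrt (k : ℝ) * Real.sqrt (((k - 1 : ℕ) : ℝ) + 1)) •
        beamSplitterState η (k - 1 + 1, l)) +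
      (Real.sqrt (1 - η) * Real.sqrt (1 - η)) • ((Real.sqrt (l : ℝ) *
        Real.sqrt (((l - 1 : ℕ) : ℝ) + 1)) • beamSplitterState η (k, l - 1 + 1)) := by
    rw [e1, e2, hk, hl]
    module
  rw [e, aAnn_eq_rot h0 h1, aDag_eq_rot h0 h1, rotAnnA_beamSplitterState h0 h1,
    rotAnnB_beamSplitterState h0 h1]
  simp only [map_add, map_smul, rotA_beamSplitterState, rotB_beamSplitterState]
  module

theorem hasSum_dot (f g : TwoMode) : HasSum (fun q => f q * g q) (dot f g) := by
  rw [dot_eq_sum f g g.support (Finset.Subset.refl _)]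
  exact hasSum_sum_of_ne_finset_zero fun q hq => by rw [Finsupp.notMem_support_iff.mp hq, mul_zero]

theorem aDag_aAnn_apply (f : TwoMode) (q : ℕ × ℕ) : aDag (aAnn f) q = q.1 * f q := by
  induction f using Finsupp.induction_linear with
  | zero => simp
  | add f g hf hg => rw [map_add, map_add, Finsupp.add_apply, hf, hg, Finsupp.add_apply]; ring
  | single p x =>
    obtain ⟨j, k⟩ := p
    rw [aAnn_single, aDag_single]
    rcases j with _ | j
    · by_cases h : (0, k) = q
      · simp [← h]
      · simp [h]
    · simp only [Nat.add_sub_cancel, Finsupp.single_apply]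
      by_cases h : (j + 1, k) = q
      · subst h
        simp only [if_true]
        push_cast
        rw [mul_assoc, Real.mul_self_sqrt (by positivity), mul_comm]
      · simp [h]

theorem hasSum_beamSplitterState_sq {η : ℝ} (h0 : 0 ≤ η) (h1 : η ≤ 1) (p : ℕ × ℕ) :
    HasSum (fun q => beamSplitterState η p q ^ 2) 1 := by
  have h := hasSum_dot (beamSplitterState η p) (beamSplitterState η p)
  rw [dot_beamSplitterState h0 h1, if_pos rfl] at h
  simpa only [sq] using h

theorem hasSum_beamSplitterState_mean {η : ℝ} (h0 : 0 ≤ η) (h1 : η ≤ 1) (k l : ℕ) :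
    HasSum (fun q : ℕ × ℕ => beamSplitterState η (k, l) q ^ 2 * (q.1 : ℝ))
      (η * k + (1 - η) * l) := by
  have h := hasSum_dot (beamSplitterState η (k, l)) (aDag (aAnn (beamSplitterState η (k, l))))
  have hd : dot (beamSplitterState η (k, l)) (aDag (aAnn (beamSplitterState η (k, l)))) =
      η * k + (1 - η) * l := by
    rw [aDag_aAnn_beamSplitterState h0 h1]
    simp only [dot_add_right, dot_smul_right, dot_beamSplitterState h0 h1]
    simp
  rw [hd] at h
  convert h using 2 with q
  rw [aDag_aAnn_apply]
  ring

/-- The number operator is diagonal in the number basis, so the second moment is the squared norm of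
its action on the state. -/
theorem hasSum_beamSplitterState_sq_mean {η : ℝ} (h0 : 0 ≤ η) (h1 : η ≤ 1) (k l : ℕ) :
    HasSum (fun q : ℕ × ℕ => beamSplitterState η (k, l) q ^ 2 * (q.1 : ℝ) ^ 2)
      ((η * k + (1 - η) * l) ^ 2 + η * (1 - η) * (2 * k * l + k + l)) := by
  have h := hasSum_dot (aDag (aAnn (beamSplitterState η (k, l))))
    (aDag (aAnn (beamSplitterState η (k, l))))
  have hd : dot (aDag (aAnn (beamSplitterState η (k, l))))
      (aDag (aAnn (beamSplitterState η (k, l)))) =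
      (η * k + (1 - η) * l) ^ 2 + η * (1 - η) * (2 * k * l + k + l) := by
    rw [aDag_aAnn_beamSplitterState h0 h1]
    -- The two off-diagonal states stay orthogonal even when `k - 1` or `l - 1` is truncated.
    have hne : ¬ (k + 1 = k - 1 ∧ l - 1 = l + 1) := by omega
    have hne' : ¬ (k - 1 = k + 1 ∧ l + 1 = l - 1) := by omega
    have e1 : Real.sqrt η * Real.sqrt η = η := Real.mul_self_sqrt h0
    have e2 : Real.sqrt (1 - η) * Real.sqrt (1 - η) = 1 - η := Real.mul_self_sqrt (by linarith)
    have e3 : Real.sqrt (k : ℝ) * Real.sqrt k = k := Real.mul_self_sqrt (by positivity)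
    have e4 : Real.sqrt (l : ℝ) * Real.sqrt l = l := Real.mul_self_sqrt (by positivity)
    have e5 : Real.sqrt ((k : ℝ) + 1) * Real.sqrt ((k : ℝ) + 1) = (k : ℝ) + 1 :=
      Real.mul_self_sqrt (by positivity)
    have e6 : Real.sqrt ((l : ℝ) + 1) * Real.sqrt ((l : ℝ) + 1) = (l : ℝ) + 1 :=
      Real.mul_self_sqrt (by positivity)
    simp only [dot_add_right, dot_smul_right, dot_add_left, dot_smul_left,
      dot_beamSplitterState h0 h1, Prod.mk.injEq, hne, hne']
    simp only [Nat.add_eq_left, one_ne_zero, and_false, if_false, if_true, mul_zero,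
      add_zero, zero_add, mul_one, Nat.left_eq_add, false_and]
    calc _ = (η * k + (1 - η) * l) ^ 2 + (Real.sqrt η * Real.sqrt η) *
          (Real.sqrt (1 - η) * Real.sqrt (1 - η)) *
          ((Real.sqrt (k : ℝ) * Real.sqrt k) *
            (Real.sqrt ((l : ℝ) + 1) * Real.sqrt ((l : ℝ) + 1)) +
          (Real.sqrt (l : ℝ) * Real.sqrt l) *
            (Real.sqrt ((k : ℝ) + 1) * Real.sqrt ((k : ℝ) + 1))) := by ring
      _ = _ := by rw [e1, e2, e3, e4, e5, e6]; ring
  rw [hd] at h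
  convert h using 2 with q
  rw [aDag_aAnn_apply]
  ring

/-! ### Photon-number moments of the thermal state -/

/-- The eigenvalue of the thermal state of mean photon number `N` at `|l⟩`. -/
def thermalProb (N : ℝ) (l : ℕ) : ℝ := 1 / (N + 1) * (N / (N + 1)) ^ l

theorem thermalProb_nonneg {N : ℝ} (hN : 0 ≤ N) (l : ℕ) : 0 ≤ thermalProb N l := by
  unfold thermalProb
  positivity

theorem norm_thermal_ratio_lt_one {N : ℝ} (hN : 0 ≤ N) : ‖N / (N + 1)‖ < 1 := by
  rw [Real.norm_of_nonneg (by positivity), div_lt_one (by positivity)]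
  linarith

theorem one_sub_thermal_ratio {N : ℝ} (hN : 0 ≤ N) : 1 - N / (N + 1) = 1 / (N + 1) := by
  have : N + 1 ≠ 0 := by positivity
  field_simp
  ring

theorem hasSum_thermalProb {N : ℝ} (hN : 0 ≤ N) : HasSum (thermalProb N) 1 := by
  have h := (hasSum_geometric_of_norm_lt_one (norm_thermal_ratio_lt_one hN)).mul_left (1 / (N + 1))
  rw [one_sub_thermal_ratio hN, mul_inv_cancel₀ (by positivity)] at h
  exact h

theorem hasSum_thermalProb_mean {N : ℝ} (hN : 0 ≤ N) :
    HasSum (fun l : ℕ => thermalProb N l * l) N := by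
  have h := (hasSum_coe_mul_geometric_of_norm_lt_one
    (norm_thermal_ratio_lt_one hN)).mul_left (1 / (N + 1))
  rw [one_sub_thermal_ratio hN] at h
  convert! h using 1
  · funext l
    rw [thermalProb]
    ring
  · have : N + 1 ≠ 0 := by positivity
    field_simp

theorem hasSum_thermalProb_sq_mean {N : ℝ} (hN : 0 ≤ N) :
    HasSum (fun l : ℕ => thermalProb N l * (l : ℝ) ^ 2) (2 * N ^ 2 + N) := by
  have h := (hasSum_choose_mul_geometric_of_norm_lt_one 2
    (norm_thermal_ratio_lt_one hN)).mul_left (2 * (1 / (N + 1)))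
  rw [one_sub_thermal_ratio hN] at h
  -- Uses `l² = 2 * choose (l + 2) 2 - 3 l - 2`.
  have h' := (h.sub ((hasSum_thermalProb_mean hN).mul_left 3)).sub
    ((hasSum_thermalProb hN).mul_left 2)
  convert! h' using 1
  · funext l
    rw [thermalProb, Nat.cast_choose_two]
    push_cast
    ring
  · have : N + 1 ≠ 0 := by positivity
    rw [one_div_pow, one_div_one_div]
    field_simp
    ring

/-! ### Output photon-number moments with a thermal environment -/

theorem hasSum_prod_of_nonneg {α β : Type*} {f : α × β → ℝ} {g : α → ℝ} {t : ℝ} (h0 : ∀ x, 0 ≤ f x)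
    (hf : ∀ a, HasSum (fun b => f (a, b)) (g a)) (hg : HasSum g t) : HasSum f t := by
  have hs : Summable f := by
    rw [summable_prod_of_nonneg h0]
    refine ⟨fun a => (hf a).summable, ?_⟩
    simpa only [(hf _).tsum_eq] using hg.summable
  have := hs.hasSum.prod_fiberwise hf
  rw [hg.unique this]
  exact hs.hasSum

/-- The joint distribution of the photon number `b` of the thermal environment and the photon
numbers `(c, d)` of the two beamsplitter outputs, for the signal input `|a⟩`. -/
def modeProb (η N : ℝ) (a : ℕ) (x : ℕ × ℕ × ℕ) : ℝ :=
  thermalProb N x.1 * beamSplitterState η (a, x.1) x.2 ^ 2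

theorem modeProb_nonneg (η : ℝ) {N : ℝ} (hN : 0 ≤ N) (a : ℕ) (x : ℕ × ℕ × ℕ) :
    0 ≤ modeProb η N a x :=
  mul_nonneg (thermalProb_nonneg hN _) (sq_nonneg _)

theorem hasSum_modeProb {η N : ℝ} (h0 : 0 ≤ η) (h1 : η ≤ 1) (hN : 0 ≤ N) (a : ℕ) :
    HasSum (modeProb η N a) 1 :=
  hasSum_prod_of_nonneg (modeProb_nonneg η hN a)
    (fun b => (hasSum_beamSplitterState_sq h0 h1 (a, b)).mul_left (thermalProb N b))
    (by simpa using hasSum_thermalProb hN)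

theorem hasSum_modeProb_mean {η N : ℝ} (h0 : 0 ≤ η) (h1 : η ≤ 1) (hN : 0 ≤ N) (a : ℕ) :
    HasSum (fun x => modeProb η N a x * (x.2.1 : ℝ)) (η * a + (1 - η) * N) := by
  refine hasSum_prod_of_nonneg (fun x => mul_nonneg (modeProb_nonneg η hN a x) (by positivity))
    (g := fun b => thermalProb N b * (η * a + (1 - η) * b)) (fun b => ?_) ?_
  · simpa only [modeProb, mul_assoc] using
      (hasSum_beamSplitterState_mean h0 h1 a b).mul_left (thermalProb N b)
  · convert! ((hasSum_thermalProb hN).mul_left (η * a)).add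
      ((hasSum_thermalProb_mean hN).mul_left (1 - η)) using 1
    · funext b
      ring
    · ring

theorem hasSum_modeProb_sq_mean {η N : ℝ} (h0 : 0 ≤ η) (h1 : η ≤ 1) (hN : 0 ≤ N) (a : ℕ) :
    HasSum (fun x => modeProb η N a x * (x.2.1 : ℝ) ^ 2)
      ((η * a + (1 - η) * N) ^ 2 +
        ((1 - η) ^ 2 * (N ^ 2 + N) + η * (1 - η) * (2 * a * N + a + N))) := by
  refine hasSum_prod_of_nonneg (fun x => mul_nonneg (modeProb_nonneg η hN a x) (by positivity))
    (g := fun b => thermalProb N b *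
      ((η * a + (1 - η) * b) ^ 2 + η * (1 - η) * (2 * a * b + a + b))) (fun b => ?_) ?_
  · simpa only [modeProb, mul_assoc] using
      (hasSum_beamSplitterState_sq_mean h0 h1 a b).mul_left (thermalProb N b)
  · convert! (((hasSum_thermalProb hN).mul_left ((η * a) ^ 2 + η * (1 - η) * a)).add
      ((hasSum_thermalProb_mean hN).mul_left
        (2 * (η * a) * (1 - η) + η * (1 - η) * (2 * a + 1)))).add
      ((hasSum_thermalProb_sq_mean hN).mul_left ((1 - η) ^ 2)) using 1
    · funext b
      ring
    · ring

end

end Bosonic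

namespace Bosonic

open scoped ENNReal BigOperators
open MeasureTheory ProbabilityTheory

noncomputable section

/-! ### Concentration of the total output photon number -/

theorem tsum_ofReal_modeProb {η N : ℝ} (h0 : 0 ≤ η) (h1 : η ≤ 1) (hN : 0 ≤ N) (a : ℕ) :
    ∑' x, ENNReal.ofReal (modeProb η N a x) = 1 := by
  have h := hasSum_modeProb h0 h1 hN a
  rw [← ENNReal.ofReal_tsum_of_nonneg (modeProb_nonneg η hN a) h.summable, h.tsum_eq,
    ENNReal.ofReal_one]

/-- The distribution `modeProb` as a measure. -/
def modeMeasure (η N : ℝ) (a : ℕ) : Measure (ℕ × ℕ × ℕ) :=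
  Measure.sum fun x => ENNReal.ofReal (modeProb η N a x) • Measure.dirac x

theorem modeMeasure_singleton (η N : ℝ) (a : ℕ) (x : ℕ × ℕ × ℕ) :
    modeMeasure η N a {x} = ENNReal.ofReal (modeProb η N a x) := by
  classical
  rw [modeMeasure, Measure.sum_apply _ (measurableSet_singleton x), tsum_eq_single x]
  · simp
  · intro y hy
    simp [hy]

theorem isProbabilityMeasure_modeMeasure {η N : ℝ} (h0 : 0 ≤ η) (h1 : η ≤ 1) (hN : 0 ≤ N)
    (a : ℕ) : IsProbabilityMeasure (modeMeasure η N a) := by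
  refine ⟨?_⟩
  rw [modeMeasure, Measure.sum_apply _ MeasurableSet.univ]
  simpa using tsum_ofReal_modeProb h0 h1 hN a

theorem lintegral_modeMeasure {η N : ℝ} (hN : 0 ≤ N) {a : ℕ} {f : ℕ × ℕ × ℕ → ℝ}
    (hf : ∀ x, 0 ≤ f x) {t : ℝ} (h : HasSum (fun x => modeProb η N a x * f x) t) :
    ∫⁻ x, ENNReal.ofReal (f x) ∂modeMeasure η N a = ENNReal.ofReal t := by
  rw [lintegral_countable', ← h.tsum_eq, ENNReal.ofReal_tsum_of_nonneg
    (fun x => mul_nonneg (modeProb_nonneg η hN a x) (hf x)) h.summable]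
  refine tsum_congr fun x => ?_
  rw [modeMeasure_singleton, ENNReal.ofReal_mul (modeProb_nonneg η hN a x), mul_comm]

theorem integrable_modeMeasure {η N : ℝ} (hN : 0 ≤ N) {a : ℕ} {f : ℕ × ℕ × ℕ → ℝ}
    (hf : ∀ x, 0 ≤ f x) {t : ℝ} (h : HasSum (fun x => modeProb η N a x * f x) t) :
    Integrable f (modeMeasure η N a) := by
  refine ⟨(Measurable.of_discrete).aestronglyMeasurable, ?_⟩
  rw [hasFiniteIntegral_iff_ofReal (Filter.Eventually.of_forall hf), lintegral_modeMeasure hN hf h]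
  exact ENNReal.ofReal_lt_top

theorem integral_modeMeasure {η N : ℝ} (hN : 0 ≤ N) {a : ℕ} {f : ℕ × ℕ × ℕ → ℝ}
    (hf : ∀ x, 0 ≤ f x) {t : ℝ} (h : HasSum (fun x => modeProb η N a x * f x) t) :
    ∫ x, f x ∂modeMeasure η N a = t := by
  rw [integral_eq_lintegral_of_nonneg_ae (Filter.Eventually.of_forall hf)
    (Measurable.of_discrete).aestronglyMeasurable, lintegral_modeMeasure hN hf h,
    ENNReal.toReal_ofReal (h.nonneg fun x => mul_nonneg (modeProb_nonneg η hN a x) (hf x))]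

/-- The photon number of the signal output, as a random variable on `modeMeasure`. -/
def outputNumber (x : ℕ × ℕ × ℕ) : ℝ := x.2.1

theorem memLp_outputNumber {η N : ℝ} (h0 : 0 ≤ η) (h1 : η ≤ 1) (hN : 0 ≤ N) (a : ℕ) :
    MemLp outputNumber 2 (modeMeasure η N a) := by
  rw [memLp_two_iff_integrable_sq (Measurable.of_discrete).aestronglyMeasurable]
  exact integrable_modeMeasure hN (fun _ => sq_nonneg _) (hasSum_modeProb_sq_mean h0 h1 hN a)

theorem integral_outputNumber {η N : ℝ} (h0 : 0 ≤ η) (h1 : η ≤ 1) (hN : 0 ≤ N) (a : ℕ) :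
    ∫ x, outputNumber x ∂modeMeasure η N a = η * a + (1 - η) * N :=
  integral_modeMeasure hN (fun _ => Nat.cast_nonneg _) (hasSum_modeProb_mean h0 h1 hN a)

theorem variance_outputNumber {η N : ℝ} (h0 : 0 ≤ η) (h1 : η ≤ 1) (hN : 0 ≤ N) (a : ℕ) :
    Var[outputNumber; modeMeasure η N a] =
      (1 - η) ^ 2 * (N ^ 2 + N) + η * (1 - η) * (2 * a * N + a + N) := by
  have := isProbabilityMeasure_modeMeasure h0 h1 hN a
  rw [variance_eq_sub (memLp_outputNumber h0 h1 hN a), integral_outputNumber h0 h1 hN a]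
  have h2 : ∫ x, (outputNumber ^ 2) x ∂modeMeasure η N a = _ :=
    integral_modeMeasure hN (fun _ => sq_nonneg _) (hasSum_modeProb_sq_mean h0 h1 hN a)
  rw [h2]
  ring

/-- Affine in `a`, so its sum over modes depends only on the total input photon number. -/
theorem variance_outputNumber_le {η N : ℝ} (h0 : 0 ≤ η) (h1 : η ≤ 1) (hN : 0 ≤ N) (a : ℕ) :
    Var[outputNumber; modeMeasure η N a] ≤ (N ^ 2 + N) + (2 * a * N + a + N) := by
  rw [variance_outputNumber h0 h1 hN a]
  have e1 : (1 - η) ^ 2 ≤ 1 := by nlinarith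
  have e2 : η * (1 - η) ≤ 1 := by nlinarith
  exact add_le_add (mul_le_of_le_one_left (by positivity) e1)
    (mul_le_of_le_one_left (by positivity) e2)

/-- The joint distribution for `n` independent modes with signal input `|a₁⟩ ⊗ ⋯ ⊗ |aₙ⟩`. -/
def modesMeasure {n : ℕ} (η N : ℝ) (a : Fin n → ℕ) : Measure (Fin n → ℕ × ℕ × ℕ) :=
  Measure.pi fun i => modeMeasure η N (a i)

/-- Chebyshev's inequality: under the product measure the variances of the modes add. -/
theorem modesMeasure_tail_le {n : ℕ} {η N : ℝ} (h0 : 0 ≤ η) (h1 : η ≤ 1) (hN : 0 ≤ N)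
    (a : Fin n → ℕ) {t : ℝ} (ht : 0 < t) :
    modesMeasure η N a {x | η * (∑ i, a i : ℕ) + (1 - η) * (n * N) + t ≤ ∑ i, outputNumber (x i)} ≤
      ENNReal.ofReal ((n * (N ^ 2 + 2 * N) + (2 * N + 1) * (∑ i, a i : ℕ)) / t ^ 2) := by
  have hp : ∀ i, IsProbabilityMeasure (modeMeasure η N (a i)) := fun i =>
    isProbabilityMeasure_modeMeasure h0 h1 hN (a i)
  have hL : ∀ i, MemLp outputNumber 2 (modeMeasure η N (a i)) := fun i =>
    memLp_outputNumber h0 h1 hN (a i)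
  set S : (Fin n → ℕ × ℕ × ℕ) → ℝ := ∑ i, fun x => outputNumber (x i) with hS
  have hLi : ∀ i : Fin n, MemLp (fun x : Fin n → ℕ × ℕ × ℕ => outputNumber (x i)) 2
      (modesMeasure η N a) := fun i =>
    (hL i).comp_measurePreserving (measurePreserving_eval (fun i => modeMeasure η N (a i)) i)
  have hSL : MemLp S 2 (modesMeasure η N a) := memLp_finsetSum' _ fun i _ => hLi i
  have hPi : IsProbabilityMeasure (modesMeasure η N a) := by
    unfold modesMeasure
    infer_instance
  have hmean : ∫ x, S x ∂modesMeasure η N a = η * (∑ i, a i : ℕ) + (1 - η) * (n * N) := by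
    simp only [hS, Finset.sum_apply]
    rw [integral_finsetSum _ fun i _ => (hLi i).integrable (by norm_num)]
    have hi : ∀ i : Fin n, ∫ x, outputNumber (x i) ∂modesMeasure η N a =
        η * a i + (1 - η) * N := fun i => by
      rw [modesMeasure, integral_comp_eval (hL i).aestronglyMeasurable,
        integral_outputNumber h0 h1 hN]
    simp_rw [hi, Finset.sum_add_distrib, ← Finset.mul_sum]
    simp
  have hvar : Var[S; modesMeasure η N a] ≤
      n * (N ^ 2 + 2 * N) + (2 * N + 1) * (∑ i, a i : ℕ) := by
    rw [hS, modesMeasure, variance_sum_pi hL]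
    calc _ ≤ ∑ i, ((N ^ 2 + N) + (2 * a i * N + a i + N)) :=
          Finset.sum_le_sum fun i _ => variance_outputNumber_le h0 h1 hN (a i)
      _ = ∑ i, ((N ^ 2 + 2 * N) + (2 * N + 1) * (a i : ℝ)) :=
          Finset.sum_congr rfl fun i _ => by ring
      _ = _ := by
          rw [Finset.sum_add_distrib, ← Finset.mul_sum, Finset.sum_const, Finset.card_univ,
            Fintype.card_fin, nsmul_eq_mul, Nat.cast_sum]
  refine (measure_mono ?_).trans ((meas_ge_le_variance_div_sq hSL ht).trans
    (ENNReal.ofReal_le_ofReal (by gcongr)))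
  intro x hx
  have hx' : η * (∑ i, a i : ℕ) + (1 - η) * (n * N) + t ≤ S x := by
    rw [hS, Finset.sum_apply]
    exact hx
  show t ≤ |S x - ∫ x, S x ∂modesMeasure η N a|
  rw [hmean]
  exact le_trans (by linarith) (le_abs_self _)

/-- Collects the environment input and the two outputs mode by mode. -/
def modesEquiv (n : ℕ) :
    (Fin n → ℕ) × (Fin n → ℕ) × (Fin n → ℕ) ≃ (Fin n → ℕ × ℕ × ℕ) where
  toFun x i := (x.1 i, x.2.1 i, x.2.2 i)
  invFun y := (fun i => (y i).1, fun i => (y i).2.1, fun i => (y i).2.2)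
  left_inv _ := rfl
  right_inv _ := rfl

theorem thermalWeight_nonneg (n : ℕ) {N : ℝ} (hN : 0 ≤ N) (b : Fin n → ℕ) :
    0 ≤ thermalWeight n N b :=
  Finset.prod_nonneg fun i _ => thermalProb_nonneg hN (b i)

/-- Thermal weights and squared matrix elements both factor over modes, so each term is the
product-measure mass of a singleton. -/
theorem modesMeasure_apply {n : ℕ} {η N : ℝ} (h0 : 0 ≤ η) (h1 : η ≤ 1) (hN : 0 ≤ N)
    (a : Fin n → ℕ) (s : Set ((Fin n → ℕ) × (Fin n → ℕ))) :
    ∑' b, ENNReal.ofReal (thermalWeight n N b) *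
        ∑' q, s.indicator (fun q => ENNReal.ofReal (beamSplitterCoeff n η (a, b) q ^ 2)) q =
      modesMeasure η N a {x | ((modesEquiv n).symm x).2 ∈ s} := by
  classical
  have hp : ∀ i, IsProbabilityMeasure (modeMeasure η N (a i)) := fun i =>
    isProbabilityMeasure_modeMeasure h0 h1 hN (a i)
  rw [← Measure.tsum_indicator_apply_singleton _ _ (MeasurableSet.of_discrete),
    ← (modesEquiv n).tsum_eq, ENNReal.tsum_prod']
  refine tsum_congr fun b => ?_
  rw [← ENNReal.tsum_mul_left]
  refine tsum_congr fun q => ?_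
  by_cases hq : q ∈ s
  · have hm : modesEquiv n (b, q) ∈ {x | ((modesEquiv n).symm x).2 ∈ s} := hq
    rw [Set.indicator_of_mem hq, Set.indicator_of_mem hm, modesMeasure, Measure.pi_singleton,
      ← ENNReal.ofReal_mul (thermalWeight_nonneg n hN b)]
    simp_rw [modeMeasure_singleton]
    rw [← ENNReal.ofReal_prod_of_nonneg fun i _ => modeProb_nonneg η hN _ _]
    congr 1
    rw [thermalWeight, beamSplitterCoeff, ← Finset.prod_pow, ← Finset.prod_mul_distrib]
    rfl
  · have hm : modesEquiv n (b, q) ∉ {x | ((modesEquiv n).symm x).2 ∈ s} := hq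
    rw [Set.indicator_of_notMem hq, Set.indicator_of_notMem hm, mul_zero]

/-- Read off from the total mass of the product measure; transmissivity `0` and vacuum input are
arbitrary choices, since the output probabilities sum to one. -/
theorem hasSum_thermalWeight (n : ℕ) {N : ℝ} (hN : 0 ≤ N) : HasSum (thermalWeight n N) 1 := by
  have hp : ∀ i : Fin n, IsProbabilityMeasure (modeMeasure 0 N ((0 : Fin n → ℕ) i)) := fun i =>
    isProbabilityMeasure_modeMeasure le_rfl zero_le_one hN _
  have h := modesMeasure_apply (n := n) le_rfl zero_le_one hN 0 Set.univ
  have hc := tsum_beamSplitterCoeff_sq n ⟨0, le_rfl, zero_le_one⟩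
  simp only [Set.indicator_univ, hc, mul_one, Set.mem_univ, modesMeasure] at h
  rw [show {_x : Fin n → ℕ × ℕ × ℕ | True} = Set.univ from rfl, measure_univ] at h
  have h' := (ENNReal.summable_toReal (h.trans_ne ENNReal.one_ne_top)).hasSum
  rw [← ENNReal.tsum_toReal_eq (fun _ => ENNReal.ofReal_ne_top), h, ENNReal.toReal_one] at h'
  simpa only [ENNReal.toReal_ofReal (thermalWeight_nonneg n hN _)] using h'

/-- On an input number state with at most `K` photons, the probability that more than `L` photons
come out. -/
theorem output_tail_le {n : ℕ} {η N : ℝ} (h0 : 0 ≤ η) (h1 : η ≤ 1) (hN : 0 ≤ N)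
    {a : Fin n → ℕ} {K L : ℕ} (ha : ∑ i, a i ≤ K) {t : ℝ} (ht : 0 < t)
    (hL : η * K + (1 - η) * (n * N) + t ≤ L) :
    ∑' b, ENNReal.ofReal (thermalWeight n N b) * ∑' q, {q : (Fin n → ℕ) × (Fin n → ℕ) |
        L < ∑ i, q.1 i}.indicator
          (fun q => ENNReal.ofReal (beamSplitterCoeff n η (a, b) q ^ 2)) q ≤
      ENNReal.ofReal ((n * (N ^ 2 + 2 * N) + (2 * N + 1) * K) / t ^ 2) := by
  have haK : ((∑ i, a i : ℕ) : ℝ) ≤ K := Nat.cast_le.mpr ha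
  rw [modesMeasure_apply h0 h1 hN]
  refine (measure_mono ?_).trans ((modesMeasure_tail_le h0 h1 hN a ht).trans
    (ENNReal.ofReal_le_ofReal (by gcongr)))
  intro x hx
  have hx' : L < ∑ i, (x i).2.1 := hx
  have hx2 : (L : ℝ) ≤ ∑ i, outputNumber (x i) := by
    have := Nat.cast_le (α := ℝ).mpr hx'.le
    rwa [Nat.cast_sum] at this
  show η * (∑ i, a i : ℕ) + (1 - η) * (n * N) + t ≤ ∑ i, outputNumber (x i)
  have := mul_le_mul_of_nonneg_left haK h0
  linarith

/-- The probability that more photons than allowed come out is at most of order `1 / n`. -/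
theorem output_tail_le_div {n : ℕ} {η N S δ : ℝ} (h0 : 0 ≤ η) (h1 : η ≤ 1) (hN : 0 ≤ N)
    (hS : 0 ≤ S) (hδ : 0 < δ) (hn : 2 ≤ n * δ) {a : Fin n → ℕ} (ha : ∑ i, a i ≤ ⌈(n : ℝ) * S⌉₊) :
    ∑' b, ENNReal.ofReal (thermalWeight n N b) * ∑' q, {q : (Fin n → ℕ) × (Fin n → ℕ) |
        ⌈(n : ℝ) * (η * S + (1 - η) * N + δ)⌉₊ < ∑ i, q.1 i}.indicator
          (fun q => ENNReal.ofReal (beamSplitterCoeff n η (a, b) q ^ 2)) q ≤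
      ENNReal.ofReal (4 * (N ^ 2 + 2 * N + (2 * N + 1) * (S + 1)) / δ ^ 2 / n) := by
  have hn0 : n ≠ 0 := by
    rintro rfl
    simp at hn
    linarith
  have hn1 : (1 : ℝ) ≤ n := by exact_mod_cast Nat.one_le_iff_ne_zero.mpr hn0
  have hK : ((⌈(n : ℝ) * S⌉₊ : ℕ) : ℝ) ≤ n * S + 1 := (Nat.ceil_lt_add_one (by positivity)).le
  have hLc := Nat.le_ceil ((n : ℝ) * (η * S + (1 - η) * N + δ))
  -- Half of the margin `n δ` absorbs the rounding of `⌈n S⌉`, which costs at most `η ≤ 1 ≤ n δ /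
  -- 2`. The other half is the Chebyshev deviation, whence the factor `4`.
  refine (output_tail_le h0 h1 hN ha (t := n * δ / 2) (by positivity) ?_).trans
    (ENNReal.ofReal_le_ofReal ?_)
  · have := mul_le_mul_of_nonneg_left hK h0
    nlinarith
  · calc (n * (N ^ 2 + 2 * N) + (2 * N + 1) * (⌈(n : ℝ) * S⌉₊ : ℕ)) / (n * δ / 2) ^ 2
        ≤ (n * (N ^ 2 + 2 * N) + (2 * N + 1) * (n * (S + 1))) / (n * δ / 2) ^ 2 := by
          gcongr
          linarith
      _ = _ := by
          field_simp
          ring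

end

end Bosonic

theorem mainTheorem3 (η : Set.Icc (0 : ℝ) 1) (N_S N_B δ₅ : ℝ)
    (hS : 0 ≤ N_S) (hB : 0 ≤ N_B) (hδ₅ : 0 < δ₅) :
    ∃ δ₆ : ℕ → ℝ, Antitone δ₆ ∧ Filter.Tendsto δ₆ Filter.atTop (nhds 0) ∧
      ∀ (δ₁ : ℕ → ℝ) (n : ℕ) (ρ : Bosonic.Fock (Fin n → ℕ) →L[ℂ] Bosonic.Fock (Fin n → ℕ)),
        Bosonic.IsDensityOperator ρ →
        1 - δ₁ n ≤ (Bosonic.trace (Bosonic.cutoffProj n ⌈(n : ℝ) * N_S⌉₊ ∘L ρ)).re →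
        1 - δ₁ n - 2 * Real.sqrt (δ₁ n) - δ₆ n ≤
          (Bosonic.trace
            (Bosonic.cutoffProj n
                ⌈(n : ℝ) * ((η : ℝ) * N_S + (1 - (η : ℝ)) * N_B + δ₅)⌉₊ ∘L
              Bosonic.thermalChannel n η N_B ρ)).re := by
  obtain ⟨η, h0, h1⟩ := η
  set C : ℝ := 4 * (N_B ^ 2 + 2 * N_B + (2 * N_B + 1) * (N_S + 1)) / δ₅ ^ 2 with hC
  have hCpos : 0 < C := by positivity
  -- `2 * C` gives `C / n ≤ D / (n + 1)` for `n ≥ 1`; `2 / δ₅ + 1` gives `D / (n + 1) ≥ 1` when `n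
  -- δ₅ < 2`.
  set D : ℝ := 2 * C + 2 / δ₅ + 1 with hD
  have hDpos : 0 < D := by positivity
  refine ⟨fun n => D / (n + 1), ?_, ?_, ?_⟩
  · intro m n hmn
    have : (m : ℝ) ≤ n := Nat.cast_le.mpr hmn
    show D / (n + 1) ≤ D / (m + 1)
    gcongr
  · simpa [div_eq_mul_inv] using (tendsto_one_div_add_atTop_nhds_zero_nat (𝕜 := ℝ)).const_mul D
  intro δ₁ n ρ hρ hcut
  rw [Bosonic.trace_cutoffProj_re] at hcut ⊢
  have hw := Bosonic.hasSum_thermalWeight n hB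
  have hw0 := Bosonic.thermalWeight_nonneg n hB
  have hsq := Real.sqrt_nonneg (δ₁ n)
  show 1 - δ₁ n - 2 * Real.sqrt (δ₁ n) - D / (n + 1) ≤ _
  have hadd : (0 : ℝ) < n + 1 := by positivity
  by_cases hn : 2 ≤ n * δ₅
  · have hn0 : n ≠ 0 := by
      rintro rfl
      simp at hn
      linarith
    have hn1 : (1 : ℝ) ≤ n := by exact_mod_cast Nat.one_le_iff_ne_zero.mpr hn0
    have hmain := Bosonic.cutoff_partialTrace_jointOutput_ge ⟨η, h0, h1⟩ hw hw0 hρ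
      (Bosonic.cutoffSet n ⌈(n : ℝ) * N_S⌉₊)
      ⌈(n : ℝ) * (η * N_S + (1 - η) * N_B + δ₅)⌉₊ (ε := C / n) (by positivity)
      (fun a ha => Bosonic.output_tail_le_div h0 h1 hB hS hδ₅ hn (Bosonic.mem_cutoffSet.mp ha))
    have hle : C / n ≤ D / (n + 1) := by
      rw [div_le_div_iff₀ (by positivity) hadd]
      have : 0 < 2 / δ₅ := by positivity
      nlinarith
    refine le_trans ?_ hmain
    linarith
  · have hJ := Bosonic.isPositive_jointOutput ⟨η, h0, h1⟩ hw.summable hw0 hρ.isPositive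
    have hJs := Bosonic.summable_diag_jointOutput ⟨η, h0, h1⟩ hw hw0 hρ
    have hone : 1 ≤ D / (n + 1) := by
      rw [le_div_iff₀ hadd]
      have : (n : ℝ) ≤ 2 / δ₅ := by
        rw [le_div_iff₀ hδ₅]
        linarith
      linarith
    -- A partial sum of the diagonal of `ρ` is at most `1`. With this the claimed lower bound is at
    -- most `0`.
    have hδ : 0 ≤ δ₁ n := by
      have := sum_le_hasSum (Bosonic.cutoffSet n ⌈(n : ℝ) * N_S⌉₊)
        (fun a _ => Bosonic.diag_nonneg hρ.isPositive a) hρ.hasSum_diag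
      linarith
    refine le_trans (b := 0) (by linarith) ?_
    exact Finset.sum_nonneg fun c _ => Bosonic.diag_partialTrace_nonneg hJ hJs c
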